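/- **Setting.** Let $\mathcal M$ be a complete (connected) $n$-dimensional Riemannian manifold with distance $\mathrm{dist}$, and let $R:T\mathcal M\to\mathcal M$ be a retraction, i.e. a smooth map with $R_x(0_x)=x$ and $\mathrm DR_x(0_x)=\mathrm{id}$ for all $x$, where $R_x=R|_{T_x\mathcal M}$. Let $\mathcal T$ be a vector transport associated to $R$: a continuous map $T\mathcal M\oplus T\mathcal M\to T\mathcal M$, $(\eta,\xi)\mapsto\mathcal T_\eta(\xi)$, such that for $\eta\in T_x\mathcal M$ the map $\mathcal T_\eta:T_x\mathcal M\to T_{R_x(\eta)}\mathcal M$ is a linear isomorphism and $\mathcal T_{0_x}=\mathrm{id}$. Assume that every $\mathcal T_\eta$ preserves inner products and that the locking condition $\mathcal T_\xi(\xi)=\beta_\xi\,\mathrm DR_x(\xi)[\xi]$, $\beta_\xi=\|\xi\|/\|\mathrm DR_x(\xi)[\xi]\|$, holds; put $\beta_{0_x}^{-1}=1$. Let $\mathrm{Inj}(\mathcal M)=\inf_x\sup\{r>0: R_x \text{ is injective on } \{\|\eta\|<r\}\subseteq T_x\mathcal M\}$. If $y=R_x(\eta)$ with $\|\eta\|<\mathrm{Inj}(\mathcal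 M)$, write $\mathcal T_{x\to y}=\mathcal T_\eta$, $\mathcal T_{x\leftarrow y}=\mathcal T_\eta^{-1}$ and $\hat{\mathcal T}_{x\leftarrow y}=\beta_\eta^{-1}\mathcal T_\eta^{-1}$. Let $f:\mathcal M\to\mathbb R$ be locally Lipschitz, and let $\partial f(x)\subseteq T_x\mathcal M$ be its Riemannian Clarke subdifferential, i.e. the Clarke subdifferential of $f\circ R_x$ at $0_x$. A point $x$ is stationary if $0_x\in\partial f(x)$. **Parameters.** $\rho\in(0,1)$, $\Gamma\ge1$, $t_{\min}\in(0,1)$, $t_{\max}\ge1$, $0<\mu_0<\mathrm{Inj}(\mathcal M)$, $D>0$, tolerance $\varepsilon=0$; $\theta_A,\theta_L,\theta_R,\theta_T>0$ with $\theta_T+\theta_A<\theta_R<\frac12$ and $\theta_L<\theta_T$; $\gamma>0$, $\kappa\in(0,\frac12)$, $\nu\ge1$. **Line search** at $(x,d,w)$ with initial stepsize $t_I$: start with $t_A=0$, $t=t_U=t_I$ and repeat the following. Compute some $g\in\partial f(R_x(td))$ and $\delta=\max\{|f(x)-f(R_x(td))+t\langle\hat{\mathcal T}_{x\leftarrow R_x(td)}g,d\rangle|,\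 \gamma(t\|d\|)^\nu\}$. If $f(R_x(td))\le f(x)-\theta_Ttw$, set $t_A=t$; otherwise set $t_U=t$. If $f(R_x(td))\le f(x)-\theta_Ltw$ and ($t\ge t_{\min}$ or $\delta>\theta_Aw$), return $t_L=t_R=t$, $\alpha=0$ and $g$. Otherwise, if $-\delta+\langle\hat{\mathcal T}_{x\leftarrow R_x(td)}g,d\rangle\ge-\theta_Rw$ and $(t-t_A)\|d\|<D$, return $t_L=0$, $t_R=t$, $\alpha=\delta$ and $g$. Otherwise choose a new $t\in[t_A+\kappa(t_U-t_A),\,t_U-\kappa(t_U-t_A)]$. **Algorithm RQNBM.** Given $x_1\in\mathcal M$ and a symmetric positive definite operator $\mathcal H_1$ on $T_{x_1}\mathcal M$, choose $g_1\in\partial f(x_1)$ and set $\tilde g_1=g_1$, $\tilde\alpha_1=0$, $w_1=\langle\tilde g_1,\tilde g_1\rangle$, $m=1$, $i_C=i_U=n_C=0$. For $k=1,2,\dots$: 1. Stop if $w_k\le\varepsilon$. Set $d_k=-\mathcal H_k\tilde g_k$, choose $t_I^k\in(0,\min\{t_{\max},\mu_0/\|d_k\|\}]$, and let the line search at $(x_k,d_k,w_k)$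 return $t_L^k$, $t_R^k$, $\alpha_{k+1}$ and $g_{k+1}$. Set $x_{k+1}=R_{x_k}(t_L^kd_k)$ and $y_{k+1}=R_{x_k}(t_R^kd_k)$, so that $g_{k+1}\in\partial f(y_{k+1})$. The step is serious if $t_L^k>0$ and null if $t_L^k=0$. 2. Set $u_k=g_{k+1}-\mathcal T_{x_k\to y_{k+1}}g_m$, $s_k=\mathcal T_{x_k\to x_{k+1}}(t_R^kd_k)$, $\tilde u_k=\mathcal T_{x_{k+1}\leftarrow y_{k+1}}u_k$, $\tilde{\mathcal H}_k=\mathcal T_{x_k\to x_{k+1}}\circ\mathcal H_k\circ\mathcal T_{x_k\leftarrow x_{k+1}}$ and $v_k=\tilde{\mathcal H}_k\tilde u_k-s_k$. 3. *Null step.* Let $\lambda_k$ minimize $\|\mathcal H_k^{1/2}(\lambda_1g_m+\lambda_2\hat{\mathcal T}_{x_k\leftarrow y_{k+1}}g_{k+1}+\lambda_3\tilde g_k)\|^2+2(\lambda_2\alpha_{k+1}+\lambda_3\tilde\alpha_k)$ over the unit simplex of $\mathbb R^3$, and set $\tilde g_{k+1}=\lambda_{k,1}g_m+\lambda_{k,2}\hat{\mathcal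 T}_{x_k\leftarrow y_{k+1}}g_{k+1}+\lambda_{k,3}\tilde g_k$ and $\tilde\alpha_{k+1}=\lambda_{k,2}\alpha_{k+1}+\lambda_{k,3}\tilde\alpha_k$. If $\langle\tilde g_k,v_k\rangle<0$ and either $i_C=0$ or both $\rho\|\tilde g_{k+1}\|^2\le\langle\tilde g_{k+1},v_k\rangle^2/\langle\tilde u_k,v_k\rangle$ and $\rho n\le\|v_k\|^2/\langle\tilde u_k,v_k\rangle$, set $i_U=1$ and $\check{\mathcal H}_{k+1}=\tilde{\mathcal H}_k-v_kv_k^\flat/\langle\tilde u_k,v_k\rangle$; otherwise set $i_U=0$ and $\check{\mathcal H}_{k+1}=\tilde{\mathcal H}_k$. 4. *Serious step.* Set $\tilde g_{k+1}=g_{k+1}$, $\tilde\alpha_{k+1}=0$, $m=k+1$. If $\langle u_k,s_k\rangle>\rho$, set $i_U=1$ and $$\check{\mathcal H}_{k+1}=\tilde{\mathcal H}_k-\frac{s_k(\tilde{\mathcal H}_k^*u_k)^\flat+(\tilde{\mathcal H}_ku_k)s_k^\flat}{\langle u_k,s_k\rangle}+\frac{\langle u_k,\tilde{\mathcal H}_ku_k\rangle+\langle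 u_k,s_k\rangle}{\langle u_k,s_k\rangle^2}s_ks_k^\flat;$$ otherwise set $i_U=0$ and $\check{\mathcal H}_{k+1}=\tilde{\mathcal H}_k$. 5. If $\|\check{\mathcal H}_{k+1}\tilde g_{k+1}\|>D$, multiply $\check{\mathcal H}_{k+1}$ by $D/\|\check{\mathcal H}_{k+1}\tilde g_{k+1}\|$. Set $\check w_{k+1}=\langle\tilde g_{k+1},\check{\mathcal H}_{k+1}\tilde g_{k+1}\rangle+2\tilde\alpha_{k+1}$. If $\check w_{k+1}<\rho\|\tilde g_{k+1}\|^2$ or $i_C=i_U=1$, set $w_{k+1}=\check w_{k+1}+\rho\|\tilde g_{k+1}\|^2$, $\mathcal H_{k+1}=\check{\mathcal H}_{k+1}+\rho\,\mathrm{id}$ and increase $n_C$ by $1$; otherwise set $w_{k+1}=\check w_{k+1}$ and $\mathcal H_{k+1}=\check{\mathcal H}_{k+1}$. If $n_C\ge\Gamma$, set $i_C=1$. **Theorem.** Assume that the level set $\{x\in\mathcal M: f(x)\le f(x_1)\}$ is bounded and that Algorithm RQNBM runs forever and generates infinitely many serious steps. Then every cluster point $x^*$ of the sequence of stability centers $\{x_k\}$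 is a stationary point of $f$ on $\mathcal M$, i.e. $0_{x^*}\in\partial f(x^*)$. -/

import Mathlib

open Set Filter Bundle
open scoped Topology Manifold ContDiff ENNReal Bundle

noncomputable section

namespace RQNBM

/-! ### Nonsmooth analysis and quasi-Newton formulas in one inner product space -/

section InnerProduct

variable {V : Type*} [NormedAddCommGroup V] [InnerProductSpace ℝ V]

/-- The Clarke directional derivative
`h°(x; d) = limsup_{y → x, t ↓ 0} (h (y + t d) - h y) / t`, with values in the extended reals
(it is finite when `h` is Lipschitz near `x`). -/
def clarkeDeriv (h : V → ℝ) (x d : V) : EReal :=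
  limsup (fun p : V × ℝ => (((h (p.1 + p.2 • d) - h p.1) / p.2 : ℝ) : EReal))
    (𝓝 x ×ˢ 𝓝[>] (0 : ℝ))

/-- The Clarke subdifferential of `h` at `x`. -/
def clarkeSubdiffVec (h : V → ℝ) (x : V) : Set V :=
  {ξ | ∀ d : V, ((inner ℝ ξ d : ℝ) : EReal) ≤ clarkeDeriv h x d}

/-- A symmetric positive definite linear operator. -/
def SymPosDef (H : V →ₗ[ℝ] V) : Prop :=
  H.IsSymmetric ∧ ∀ v : V, v ≠ 0 → 0 < inner ℝ v (H v)

/-- The operator `a b^♭ : v ↦ ⟨b, v⟩ a`. -/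
def outer (a b : V) : V →ₗ[ℝ] V := (innerₗ V b).smulRight a

/-- The SR1 formula `H - v v^♭ / ⟨u, v⟩`. -/
def sr1 (H : V →ₗ[ℝ] V) (u v : V) : V →ₗ[ℝ] V :=
  H - (inner ℝ u v)⁻¹ • outer v v

/-- The BFGS formula (for the inverse Hessian)
`H - s (H* u)^♭ / ⟨u, s⟩ - (H u) s^♭ / ⟨u, s⟩ + a s s^♭ / ⟨u, s⟩²`, `a = ⟨u, H u⟩ + ⟨u, s⟩`.
The operator `s (H* u)^♭ : v ↦ ⟨H* u, v⟩ s = ⟨u, H v⟩ s` is the composition `s u^♭ ∘ H`. -/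
def bfgs (H : V →ₗ[ℝ] V) (u s : V) : V →ₗ[ℝ] V :=
  H - (inner ℝ u s)⁻¹ • (outer s u ∘ₗ H) - (inner ℝ u s)⁻¹ • outer (H u) s
    + ((inner ℝ u (H u) + inner ℝ u s) / (inner ℝ u s) ^ 2) • outer s s

/-- The objective of the three-variable quadratic subproblem,
`‖H^{1/2} z‖² + 2 (l₂ α + l₃ α̃)` with `z = l₁ g_m + l₂ ĝ + l₃ g̃`; here `‖H^{1/2} z‖² = ⟨z, H z⟩`.
The three multipliers are `l 0`, `l 1`, `l 2`. -/
def qpObj (H : V →ₗ[ℝ] V) (gm gnew gt : V) (α αt : ℝ) (l : Fin 3 → ℝ) : ℝ :=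
  inner ℝ (l 0 • gm + l 1 • gnew + l 2 • gt) (H (l 0 • gm + l 1 • gnew + l 2 • gt))
    + 2 * (l 1 * α + l 2 * αt)

/-- `l` solves the quadratic subproblem: it minimizes the objective over the unit simplex. -/
def IsQPSolution (H : V →ₗ[ℝ] V) (gm gnew gt : V) (α αt : ℝ) (l : Fin 3 → ℝ) : Prop :=
  l ∈ stdSimplex ℝ (Fin 3) ∧
    ∀ l' ∈ stdSimplex ℝ (Fin 3), qpObj H gm gnew gt α αt l ≤ qpObj H gm gnew gt α αt l'

end InnerProduct

/-! ### Retractions and vector transports -/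

section Retraction

variable {n : ℕ} {M : Type*} [TopologicalSpace M] [ChartedSpace (EuclideanSpace ℝ (Fin n)) M]
  [IsManifold (𝓡 n) ∞ M]

/-- The differential `D R_x(ξ) : T_x M → T_{R_x(ξ)} M` of the restriction `R_x` of `R` to the
vector space `T_x M`. -/
def fiberDeriv (R : TangentBundle (𝓡 n) M → M) (x : M) (ξ : TangentSpace (𝓡 n) x) :
    TangentSpace (𝓡 n) x →L[ℝ] TangentSpace (𝓡 n) (R ⟨x, ξ⟩) :=
  mfderiv 𝓘(ℝ, EuclideanSpace ℝ (Fin n)) (𝓡 n)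
    (fun v : EuclideanSpace ℝ (Fin n) => R ⟨x, v⟩) ξ

/-- A retraction: a smooth map `R : TM → M` with `R_x(0) = x` and `D R_x(0) = id`. The latter is
an equality of tangent vectors, written in the tangent bundle. -/
structure IsRetraction (R : TangentBundle (𝓡 n) M → M) : Prop where
  smooth : ContMDiff (𝓡 n).tangent (𝓡 n) ∞ R
  map_zero : ∀ x : M, R ⟨x, 0⟩ = x
  deriv_zero : ∀ (x : M) (v : TangentSpace (𝓡 n) x),
    (⟨R ⟨x, 0⟩, fiberDeriv R x 0 v⟩ : TangentBundle (𝓡 n) M) = ⟨x, v⟩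

/-- A vector transport associated to `R`: a continuous map `(η, ξ) ↦ T_η(ξ)` from the Whitney sum
`TM ⊕ TM` to `TM`, such that `T_η` is a linear isomorphism from `T_x M` to `T_{R(η)} M` for
`η ∈ T_x M`, and `T_{0_x}` is the identity. -/
structure VectorTransport (R : TangentBundle (𝓡 n) M → M) where
  map : ∀ (x : M) (η : TangentSpace (𝓡 n) x),
    TangentSpace (𝓡 n) x ≃ₗ[ℝ] TangentSpace (𝓡 n) (R ⟨x, η⟩)
  continuous_map : Continuous
    (fun p : TotalSpace (EuclideanSpace ℝ (Fin n) × EuclideanSpace ℝ (Fin n))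
        ((TangentSpace (𝓡 n) : M → Type) ×ᵇ (TangentSpace (𝓡 n) : M → Type)) =>
      (⟨R ⟨p.1, p.2.1⟩, map p.1 p.2.1 p.2.2⟩ : TangentBundle (𝓡 n) M))
  map_zero : ∀ (x : M) (ξ : TangentSpace (𝓡 n) x),
    (⟨R ⟨x, 0⟩, map x 0 ξ⟩ : TangentBundle (𝓡 n) M) = ⟨x, ξ⟩

end Retraction

section Riemannian

variable {n : ℕ} {M : Type*} [TopologicalSpace M] [ChartedSpace (EuclideanSpace ℝ (Fin n)) M]
  [IsManifold (𝓡 n) ∞ M] [RiemannianBundle (fun x : M => TangentSpace (𝓡 n) x)]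

/-- The vector transport preserves inner products. -/
def VectorTransport.IsIsometric {R : TangentBundle (𝓡 n) M → M} (T : VectorTransport R) : Prop :=
  ∀ (x : M) (η ξ ζ : TangentSpace (𝓡 n) x),
    inner ℝ (T.map x η ξ) (T.map x η ζ) = inner ℝ ξ ζ

/-- The locking condition `T_ξ(ξ) = β_ξ D R_x(ξ)[ξ]` with `β_ξ = ‖ξ‖ / ‖D R_x(ξ)[ξ]‖`
(both sides vanish for `ξ = 0`). -/
def VectorTransport.IsLocking {R : TangentBundle (𝓡 n) M → M} (T : VectorTransport R) : Prop :=
  ∀ (x : M) (ξ : TangentSpace (𝓡 n) x),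
    T.map x ξ ξ = (‖ξ‖ / ‖fiberDeriv R x ξ ξ‖) • fiberDeriv R x ξ ξ

open Classical in
/-- `β_ξ⁻¹ = ‖D R_x(ξ)[ξ]‖ / ‖ξ‖`, with the convention `β_{0_x}⁻¹ = 1`. -/
def betaInv (R : TangentBundle (𝓡 n) M → M) (x : M) (ξ : TangentSpace (𝓡 n) x) : ℝ :=
  if ξ = 0 then 1 else ‖fiberDeriv R x ξ ξ‖ / ‖ξ‖

/-- The injectivity radius at `x` with respect to `R`:
the supremum of all `r > 0` such that `R_x` is injective on the ball `B(0_x, r)`. -/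
def injRadiusAt (R : TangentBundle (𝓡 n) M → M) (x : M) : ℝ≥0∞ :=
  ⨆ (r : ℝ) (_ : 0 < r)
    (_ : InjOn (fun v : TangentSpace (𝓡 n) x => R ⟨x, v⟩) (Metric.ball 0 r)), ENNReal.ofReal r

/-- The injectivity radius `Inj(M) = inf_x Inj(x)` with respect to `R`. -/
def injRadius (R : TangentBundle (𝓡 n) M → M) : ℝ≥0∞ := ⨅ x : M, injRadiusAt R x

/-- Below the injectivity radius `R_x⁻¹` is well defined: `η` is the only tangent vector of norm
less than `Inj(x)` that `R_x` sends to `R_x(η)`. Hence, for `y = R_x(η)` with such an `η`, one has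
`R_x⁻¹(y) = η`, and the transports `T_{x → y}`, `T_{x ← y}` are `T_η` and `T_η⁻¹`. -/
theorem eq_of_retraction_eq {R : TangentBundle (𝓡 n) M → M} {x : M}
    {η ζ : TangentSpace (𝓡 n) x} (hη : ENNReal.ofReal ‖η‖ < injRadiusAt R x)
    (hζ : ENNReal.ofReal ‖ζ‖ < injRadiusAt R x) (h : R ⟨x, η⟩ = R ⟨x, ζ⟩) : η = ζ := by
  have key : ENNReal.ofReal (max ‖η‖ ‖ζ‖) < injRadiusAt R x := by
    rcases max_choice ‖η‖ ‖ζ‖ with h | h <;> rw [h] <;> assumption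
  simp only [injRadiusAt, lt_iSup_iff] at key
  obtain ⟨r, hr, hinj, hlt⟩ := key
  have hlt' : max ‖η‖ ‖ζ‖ < r := (ENNReal.ofReal_lt_ofReal_iff hr).1 hlt
  refine hinj ?_ ?_ h
  · simpa using lt_of_le_of_lt (le_max_left _ _) hlt'
  · simpa using lt_of_le_of_lt (le_max_right _ _) hlt'

/-- The Riemannian Clarke subdifferential `∂f(x) = ∂(f ∘ R_x)(0_x) ⊆ T_x M`. -/
def clarkeSubdiff (R : TangentBundle (𝓡 n) M → M) (f : M → ℝ) (x : M) :
    Set (TangentSpace (𝓡 n) x) :=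
  clarkeSubdiffVec (fun v : TangentSpace (𝓡 n) x => f (R ⟨x, v⟩)) 0

/-- The transport `T̂_{x ← y} = β_η⁻¹ T_η⁻¹ : T_y M → T_x M`, where `y = R_x(η)`. -/
def VectorTransport.hatBack {R : TangentBundle (𝓡 n) M → M} (T : VectorTransport R) (x : M)
    (η : TangentSpace (𝓡 n) x) (g : TangentSpace (𝓡 n) (R ⟨x, η⟩)) : TangentSpace (𝓡 n) x :=
  betaInv R x η • (T.map x η).symm g

end Riemannian

/-! ### The algorithm -/

/-- The parameters of the method and of its line search, with their admissible ranges. -/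
structure Params where
  /-- correction parameters -/
  ρ : ℝ
  Γ : ℝ
  /-- stepsize control parameters -/
  tmin : ℝ
  tmax : ℝ
  μ₀ : ℝ
  /-- length control -/
  D : ℝ
  /-- tolerance -/
  ε : ℝ
  /-- line search parameters -/
  θA : ℝ
  θL : ℝ
  θR : ℝ
  θT : ℝ
  γ : ℝ
  κ : ℝ
  ν : ℝ
  ρ_pos : 0 < ρ
  ρ_lt : ρ < 1
  one_le_Γ : 1 ≤ Γ
  tmin_pos : 0 < tmin
  tmin_lt : tmin < 1
  one_le_tmax : 1 ≤ tmax
  μ₀_pos : 0 < μ₀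
  D_pos : 0 < D
  ε_nonneg : 0 ≤ ε
  θA_pos : 0 < θA
  θL_pos : 0 < θL
  θR_pos : 0 < θR
  θT_pos : 0 < θT
  θTA_lt : θT + θA < θR
  θR_lt : θR < 1 / 2
  θL_lt : θL < θT
  γ_pos : 0 < γ
  κ_pos : 0 < κ
  κ_lt : κ < 1 / 2
  one_le_ν : 1 ≤ ν

section Algorithm

variable {n : ℕ} {M : Type*} [TopologicalSpace M] [ChartedSpace (EuclideanSpace ℝ (Fin n)) M]
  [IsManifold (𝓡 n) ∞ M]

variable (n M) in
/-- The variables that the method carries from one iteration to the next: the stability center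
`x_k`, the basic subgradient `g_m ∈ ∂f(x_k)`, the aggregate subgradient `g̃_k`, the operator `H_k`,
the aggregate subgradient locality measure `α̃_k`, the number `w_k`, the counter `n_C`, and the
statement `i_C = 1`. The indicator `i_U` is reset in every iteration before it is used. -/
structure State where
  x : M
  gm : TangentSpace (𝓡 n) x
  gt : TangentSpace (𝓡 n) x
  H : TangentSpace (𝓡 n) x →ₗ[ℝ] TangentSpace (𝓡 n) x
  αt : ℝ
  w : ℝ
  nC : ℕ
  iC : Prop

/-- The search direction `d_k = - H_k g̃_k`. -/
def State.dir (S : State n M) : TangentSpace (𝓡 n) S.x := -(S.H S.gt)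

/-- The trial point `R_{x_k}(t d_k)`. -/
abbrev State.trial (R : TangentBundle (𝓡 n) M → M) (S : State n M) (t : ℝ) : M :=
  R ⟨S.x, t • S.dir⟩

variable [RiemannianBundle (fun x : M => TangentSpace (𝓡 n) x)]

/-- The slope `⟨T̂_{x_k ← R_{x_k}(t d_k)} g, d_k⟩`. -/
def State.slope {R : TangentBundle (𝓡 n) M → M} (T : VectorTransport R) (S : State n M) (t : ℝ)
    (g : TangentSpace (𝓡 n) (S.trial R t)) : ℝ :=
  inner ℝ (T.hatBack S.x (t • S.dir) g) S.dir

/-- The number `δ` of the line search, for the stepsize `t` and `g ∈ ∂f(R_{x_k}(t d_k))`. -/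
def State.delta (P : Params) (f : M → ℝ) {R : TangentBundle (𝓡 n) M → M} (T : VectorTransport R)
    (S : State n M) (t : ℝ) (g : TangentSpace (𝓡 n) (S.trial R t)) : ℝ :=
  max |f S.x - f (S.trial R t) + t * S.slope T t g| (P.γ * (t * ‖S.dir‖) ^ P.ν)

/-- The test by which the line search decides whether `t` replaces `t_A` or `t_U`. -/
def State.LSTest (P : Params) (f : M → ℝ) (R : TangentBundle (𝓡 n) M → M)
    (S : State n M) (t : ℝ) : Prop :=
  f (S.trial R t) ≤ f S.x - P.θT * t * S.w

/-- The test that ends the line search with a serious step. -/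
def State.LSSerious (P : Params) (f : M → ℝ) {R : TangentBundle (𝓡 n) M → M}
    (T : VectorTransport R) (S : State n M) (t : ℝ)
    (g : TangentSpace (𝓡 n) (S.trial R t)) : Prop :=
  f (S.trial R t) ≤ f S.x - P.θL * t * S.w ∧ (P.tmin ≤ t ∨ P.θA * S.w < S.delta P f T t g)

/-- The test that ends the line search with a null step (`tA` is the updated value). -/
def State.LSNull (P : Params) (f : M → ℝ) {R : TangentBundle (𝓡 n) M → M}
    (T : VectorTransport R) (S : State n M) (tA t : ℝ)
    (g : TangentSpace (𝓡 n) (S.trial R t)) : Prop :=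
  -P.θR * S.w ≤ -S.delta P f T t g + S.slope T t g ∧ (t - tA) * ‖S.dir‖ < P.D

open Classical in
/-- The value of `t_A` after the test at `t`. -/
def State.newA (P : Params) (f : M → ℝ) (R : TangentBundle (𝓡 n) M → M) (S : State n M)
    (tA t : ℝ) : ℝ :=
  if S.LSTest P f R t then t else tA

open Classical in
/-- The value of `t_U` after the test at `t`. -/
def State.newU (P : Params) (f : M → ℝ) (R : TangentBundle (𝓡 n) M → M) (S : State n M)
    (tU t : ℝ) : ℝ :=
  if S.LSTest P f R t then tU else t

/-- `S.LSReach P f T tI tA tU t`: the line search, started with the stepsize `tI`, can arrive at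
the beginning of a pass of its loop with these values of `t_A`, `t_U` and `t`. -/
inductive State.LSReach (P : Params) (f : M → ℝ) {R : TangentBundle (𝓡 n) M → M}
    (T : VectorTransport R) (S : State n M) (tI : ℝ) : ℝ → ℝ → ℝ → Prop
  | init : State.LSReach P f T S tI 0 tI tI
  | next {tA tU t : ℝ} (h : State.LSReach P f T S tI tA tU t)
      (g : TangentSpace (𝓡 n) (S.trial R t)) (hg : g ∈ clarkeSubdiff R f (S.trial R t))
      (hS : ¬ S.LSSerious P f T t g) (hN : ¬ S.LSNull P f T (S.newA P f R tA t) t g)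
      (t' : ℝ)
      (ht' : t' ∈ Icc
        (S.newA P f R tA t + P.κ * (S.newU P f R tU t - S.newA P f R tA t))
        (S.newU P f R tU t - P.κ * (S.newU P f R tU t - S.newA P f R tA t))) :
      State.LSReach P f T S tI (S.newA P f R tA t) (S.newU P f R tU t) t'

/-- The admissible initial stepsizes `0 < t_I ≤ min {t_max, μ₀ / ‖d_k‖}` (with `μ₀ / 0 = ∞`). -/
def State.IsInitStep (P : Params) (S : State n M) (tI : ℝ) : Prop :=
  0 < tI ∧ tI ≤ P.tmax ∧ tI * ‖S.dir‖ ≤ P.μ₀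

/-- The line search at `S` can return `t_L = t_R = t` after computing `g ∈ ∂f(R_{x_k}(t d_k))`
at the stepsize `t`. -/
def State.SeriousExit (P : Params) (f : M → ℝ) {R : TangentBundle (𝓡 n) M → M}
    (T : VectorTransport R) (S : State n M) (t : ℝ)
    (g : TangentSpace (𝓡 n) (S.trial R t)) : Prop :=
  ∃ tI tA tU : ℝ, S.IsInitStep P tI ∧ S.LSReach P f T tI tA tU t ∧
    g ∈ clarkeSubdiff R f (S.trial R t) ∧ S.LSSerious P f T t g

/-- The line search at `S` can return `t_L = 0`, `t_R = t` after computing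
`g ∈ ∂f(R_{x_k}(t d_k))` at the stepsize `t`. -/
def State.NullExit (P : Params) (f : M → ℝ) {R : TangentBundle (𝓡 n) M → M}
    (T : VectorTransport R) (S : State n M) (t : ℝ)
    (g : TangentSpace (𝓡 n) (S.trial R t)) : Prop :=
  ∃ tI tA tU : ℝ, S.IsInitStep P tI ∧ S.LSReach P f T tI tA tU t ∧
    g ∈ clarkeSubdiff R f (S.trial R t) ∧ ¬ S.LSSerious P f T t g ∧
      S.LSNull P f T (S.newA P f R tA t) t g

open Classical in
/-- The scaling of `Hc` (`= Ȟ_{k+1}`) to `‖Hc g̃_{k+1}‖ ≤ D`. -/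
def scaled (P : Params) {x : M} (gt : TangentSpace (𝓡 n) x)
    (Hc : TangentSpace (𝓡 n) x →ₗ[ℝ] TangentSpace (𝓡 n) x) :
    TangentSpace (𝓡 n) x →ₗ[ℝ] TangentSpace (𝓡 n) x :=
  if P.D < ‖Hc gt‖ then (P.D / ‖Hc gt‖) • Hc else Hc

/-- The number `w̌_{k+1} = ⟨g̃_{k+1}, Ȟ_{k+1} g̃_{k+1}⟩ + 2 α̃_{k+1}` for the scaled operator. -/
def wCheck (P : Params) {x : M} (gt : TangentSpace (𝓡 n) x) (αt : ℝ)
    (Hc : TangentSpace (𝓡 n) x →ₗ[ℝ] TangentSpace (𝓡 n) x) : ℝ :=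
  inner ℝ gt (scaled P gt Hc gt) + 2 * αt

/-- The condition under which the correction is made. -/
def NeedsCorrection (P : Params) {x : M} (gt : TangentSpace (𝓡 n) x) (αt : ℝ)
    (Hc : TangentSpace (𝓡 n) x →ₗ[ℝ] TangentSpace (𝓡 n) x) (iU iC : Prop) : Prop :=
  wCheck P gt αt Hc < P.ρ * ‖gt‖ ^ 2 ∨ (iC ∧ iU)

open Classical in
/-- The common last part of an iteration: scaling, correction, and the update of `n_C` and `i_C`.
The arguments are `x_{k+1}`, `g_m`, `g̃_{k+1}`, `α̃_{k+1}`, the operator `Ȟ_{k+1}` before scaling,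
the statement `i_U = 1`, and the old values of `n_C` and `i_C = 1`. -/
def finish (P : Params) (x : M) (gm gt : TangentSpace (𝓡 n) x) (αt : ℝ)
    (Hc : TangentSpace (𝓡 n) x →ₗ[ℝ] TangentSpace (𝓡 n) x) (iU : Prop) (nC : ℕ) (iC : Prop) :
    State n M where
  x := x
  gm := gm
  gt := gt
  H := if NeedsCorrection P gt αt Hc iU iC then scaled P gt Hc + P.ρ • LinearMap.id
    else scaled P gt Hc
  αt := αt
  w := if NeedsCorrection P gt αt Hc iU iC then wCheck P gt αt Hc + P.ρ * ‖gt‖ ^ 2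
    else wCheck P gt αt Hc
  nC := if NeedsCorrection P gt αt Hc iU iC then nC + 1 else nC
  iC := iC ∨ P.Γ ≤ ((if NeedsCorrection P gt αt Hc iU iC then nC + 1 else nC : ℕ) : ℝ)

/-- After a null step `x_{k+1} = x_k`, so that `T_{x_k → x_{k+1}}` is the identity:
`ũ_k = T_{x_k ← y_{k+1}} u_k` with `u_k = g_{k+1} - T_{x_k → y_{k+1}} g_m`. -/
def State.nullU {R : TangentBundle (𝓡 n) M → M} (T : VectorTransport R) (S : State n M) (t : ℝ)
    (g : TangentSpace (𝓡 n) (S.trial R t)) : TangentSpace (𝓡 n) S.x :=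
  (T.map S.x (t • S.dir)).symm (g - T.map S.x (t • S.dir) S.gm)

/-- `v_k = H̃_k ũ_k - s_k` after a null step, where `H̃_k = H_k` and `s_k = t_R d_k`. -/
def State.nullV {R : TangentBundle (𝓡 n) M → M} (T : VectorTransport R) (S : State n M) (t : ℝ)
    (g : TangentSpace (𝓡 n) (S.trial R t)) : TangentSpace (𝓡 n) S.x :=
  S.H (S.nullU T t g) - t • S.dir

/-- The aggregate subgradient `g̃_{k+1}` for the multipliers `l`. -/
def State.aggSubgrad {R : TangentBundle (𝓡 n) M → M} (T : VectorTransport R) (S : State n M)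
    (t : ℝ) (g : TangentSpace (𝓡 n) (S.trial R t)) (l : Fin 3 → ℝ) : TangentSpace (𝓡 n) S.x :=
  l 0 • S.gm + l 1 • T.hatBack S.x (t • S.dir) g + l 2 • S.gt

/-- The condition for the SR1 update: `⟨g̃_k, v_k⟩ < 0`, and either `i_C = 0` or both
`ρ ‖g̃_{k+1}‖² ≤ ⟨g̃_{k+1}, v_k⟩² / ⟨ũ_k, v_k⟩` and `ρ n ≤ ‖v_k‖² / ⟨ũ_k, v_k⟩`. -/
def State.SR1Cond (P : Params) {R : TangentBundle (𝓡 n) M → M} (T : VectorTransport R)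
    (S : State n M) (t : ℝ) (g : TangentSpace (𝓡 n) (S.trial R t)) (l : Fin 3 → ℝ) : Prop :=
  inner ℝ S.gt (S.nullV T t g) < 0 ∧
    (¬ S.iC ∨
      (P.ρ * ‖S.aggSubgrad T t g l‖ ^ 2
          ≤ inner ℝ (S.aggSubgrad T t g l) (S.nullV T t g) ^ 2
            / inner ℝ (S.nullU T t g) (S.nullV T t g) ∧
        P.ρ * n ≤ ‖S.nullV T t g‖ ^ 2 / inner ℝ (S.nullU T t g) (S.nullV T t g)))

open Classical in
/-- The state after a null step with stepsize `t`, new subgradient `g` and multipliers `l`;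
the new locality measure `α_{k+1}` is the number `δ` of the line search. -/
def State.nullNext (P : Params) (f : M → ℝ) {R : TangentBundle (𝓡 n) M → M}
    (T : VectorTransport R) (S : State n M) (t : ℝ) (g : TangentSpace (𝓡 n) (S.trial R t))
    (l : Fin 3 → ℝ) : State n M :=
  finish P S.x S.gm (S.aggSubgrad T t g l) (l 1 * S.delta P f T t g + l 2 * S.αt)
    (if S.SR1Cond P T t g l then sr1 S.H (S.nullU T t g) (S.nullV T t g) else S.H)
    (S.SR1Cond P T t g l) S.nC S.iC

/-- `H̃_k = T_{x_k → x_{k+1}} ∘ H_k ∘ T_{x_k ← x_{k+1}}` for a serious step with stepsize `t`. -/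
def State.seriousH {R : TangentBundle (𝓡 n) M → M} (T : VectorTransport R) (S : State n M)
    (t : ℝ) : TangentSpace (𝓡 n) (S.trial R t) →ₗ[ℝ] TangentSpace (𝓡 n) (S.trial R t) :=
  (T.map S.x (t • S.dir)).toLinearMap ∘ₗ S.H ∘ₗ (T.map S.x (t • S.dir)).symm.toLinearMap

/-- `u_k = g_{k+1} - T_{x_k → y_{k+1}} g_m` for a serious step, where `x_{k+1} = y_{k+1}`. -/
def State.seriousU {R : TangentBundle (𝓡 n) M → M} (T : VectorTransport R) (S : State n M)
    (t : ℝ) (g : TangentSpace (𝓡 n) (S.trial R t)) : TangentSpace (𝓡 n) (S.trial R t) :=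
  g - T.map S.x (t • S.dir) S.gm

/-- `s_k = T_{x_k → x_{k+1}} (t_R d_k)` for a serious step. -/
def State.seriousS {R : TangentBundle (𝓡 n) M → M} (T : VectorTransport R) (S : State n M)
    (t : ℝ) : TangentSpace (𝓡 n) (S.trial R t) :=
  T.map S.x (t • S.dir) (t • S.dir)

/-- The condition for the BFGS update. -/
def State.BFGSCond (P : Params) {R : TangentBundle (𝓡 n) M → M} (T : VectorTransport R)
    (S : State n M) (t : ℝ) (g : TangentSpace (𝓡 n) (S.trial R t)) : Prop :=
  P.ρ < inner ℝ (S.seriousU T t g) (S.seriousS T t)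

open Classical in
/-- The state after a serious step with stepsize `t` and new subgradient `g`. -/
def State.seriousNext (P : Params) {R : TangentBundle (𝓡 n) M → M} (T : VectorTransport R)
    (S : State n M) (t : ℝ) (g : TangentSpace (𝓡 n) (S.trial R t)) : State n M :=
  finish P (S.trial R t) g g 0
    (if S.BFGSCond P T t g then bfgs (S.seriousH T t) (S.seriousU T t g) (S.seriousS T t)
      else S.seriousH T t)
    (S.BFGSCond P T t g) S.nC S.iC

/-- `S'` is a possible result of one iteration of the method at `S`, in which the line search
returns the stepsizes `tL` and `tR`. The new subgradient `g_{k+1} ∈ ∂f(y_{k+1})` is the one that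
the line search has computed at the accepted stepsize. -/
inductive State.Iter (P : Params) (f : M → ℝ) {R : TangentBundle (𝓡 n) M → M}
    (T : VectorTransport R) (S : State n M) : ℝ → ℝ → State n M → Prop
  | null (t : ℝ) (g : TangentSpace (𝓡 n) (S.trial R t)) (l : Fin 3 → ℝ)
      (hexit : S.NullExit P f T t g)
      (hl : IsQPSolution S.H S.gm (T.hatBack S.x (t • S.dir) g) S.gt (S.delta P f T t g) S.αt l) :
      State.Iter P f T S 0 t (S.nullNext P f T t g l)
  | serious (t : ℝ) (g : TangentSpace (𝓡 n) (S.trial R t)) (hexit : S.SeriousExit P f T t g) :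
      State.Iter P f T S t t (S.seriousNext P T t g)

/-- The states in which the method can start: `g̃ = g_m = g_1 ∈ ∂f(x_1)`, `α̃ = 0`,
`w = ⟨g̃, g̃⟩`, `n_C = i_C = 0`, and a symmetric positive definite operator. -/
def State.IsInitial (R : TangentBundle (𝓡 n) M → M) (f : M → ℝ) (S : State n M) : Prop :=
  S.gm ∈ clarkeSubdiff R f S.x ∧ S.gt = S.gm ∧ SymPosDef S.H ∧ S.αt = 0 ∧
    S.w = inner ℝ S.gt S.gt ∧ S.nC = 0 ∧ ¬ S.iC

/-- An infinite run of the method. The iterations are numbered from `0`; `tL k` and `tR k` are the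
stepsizes that the line search returns in iteration `k`, which is a serious step if `0 < tL k`
and a null step if `tL k = 0`. The stopping test `w_k ≤ ε` fails in every iteration. -/
structure IsRun (P : Params) (f : M → ℝ) {R : TangentBundle (𝓡 n) M → M} (T : VectorTransport R)
    (S : ℕ → State n M) (tL tR : ℕ → ℝ) : Prop where
  start : (S 0).IsInitial R f
  not_stopped : ∀ k, P.ε < (S k).w
  iter : ∀ k, (S k).Iter P f T (tL k) (tR k) (S (k + 1))

end Algorithm

end RQNBM

end

/-! Argue by contradiction at a cluster point `x₀` that is not stationary. The Clarke derivative of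
`f ∘ R_{x₀}` at `0` is then negative in some direction. This persists nearby: there are a vector
field `d` and numbers `c, r > 0` such that, for `x` near `x₀` and `‖η‖ < r`, every subgradient at
`R_x(η)`, transported back to `T_x M`, has inner product at most `-c` with `d x`
(`VectorTransport.IsIsometric.exists_eventually_inner_hatBack_le`). Trial points at distance `r` or
more escape this estimate, but their locality measure is at least `γ r ^ ν`, and their transported
subgradients are bounded.

Hence, for a suitable `A`, all pairs of a transported subgradient and its locality measure lie in
the convex set of bounded `v` with `⟨v, d x⟩ ≤ -c + A α`. The aggregate pair `(g̃_k, α̃_k)` is a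
convex combination of such pairs in one tangent space, because the center is fixed during null steps
and the pair is reset at a serious step; so it lies there too. It follows that `g̃_k` and `α̃_k`
cannot both be small. The quasi-Newton updates keep `H_k` positive semidefinite, so `w_k ≥ 2 α̃_k`,
and the correction enforces `w_k ≥ ρ ‖g̃_k‖ ^ 2`. Therefore `w_k ≥ w₀ > 0` whenever `x_k` is near
`x₀` (`IsRun.exists_eventually_le_w`).

On the other hand `f (x_k)` decreases to `f x₀`, and a serious step gains at least `θ_L t_L w_k`. So
serious steps taken late from centers near `x₀` have small `t_L`, and by the scaling of `H_k` they
are also short. With `t_L < t_min` the line search accepts only if `δ > θ_A w_k ≥ θ_A w₀`, whereas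
`δ` tends to zero with the length of the step (`exists_eventually_delta_le`). This is the
contradiction in `IsRun.zero_mem_clarkeSubdiff`. -/

noncomputable section

namespace RQNBM

/-! ### Clarke derivatives as eventual inequalities between real numbers -/

section Clarke

variable {V : Type*} [NormedAddCommGroup V] [InnerProductSpace ℝ V]

/-- Multiplying by the positive step removes both the quotient and `EReal`; inequalities of this
form are easy to carry through charts. The next lemma is the converse passage, at the price of a
strict bound. -/
theorem clarkeDeriv_le_of_eventually {h : V → ℝ} {x d : V} {c : ℝ}
    (H : ∀ᶠ p : V × ℝ in 𝓝 x ×ˢ 𝓝[>] (0 : ℝ), h (p.1 + p.2 • d) - h p.1 ≤ c * p.2) :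
    clarkeDeriv h x d ≤ c := by
  refine limsup_le_of_le (by isBoundedDefault) ?_
  have hpos : ∀ᶠ p : V × ℝ in 𝓝 x ×ˢ 𝓝[>] (0 : ℝ), 0 < p.2 :=
    tendsto_snd.eventually self_mem_nhdsWithin
  filter_upwards [H, hpos] with p hp h0
  exact EReal.coe_le_coe_iff.2 ((div_le_iff₀ h0).2 hp)

theorem eventually_of_clarkeDeriv_lt {h : V → ℝ} {x d : V} {c : ℝ}
    (H : clarkeDeriv h x d < c) :
    ∀ᶠ p : V × ℝ in 𝓝 x ×ˢ 𝓝[>] (0 : ℝ), h (p.1 + p.2 • d) - h p.1 ≤ c * p.2 := by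
  have hpos : ∀ᶠ p : V × ℝ in 𝓝 x ×ˢ 𝓝[>] (0 : ℝ), 0 < p.2 :=
    tendsto_snd.eventually self_mem_nhdsWithin
  filter_upwards [eventually_lt_of_limsup_lt H, hpos] with p hp h0
  exact (div_le_iff₀ h0).1 (EReal.coe_lt_coe_iff.1 hp).le

end Clarke

/-! ### Difference estimates for a family of reparametrizations of a Lipschitz function -/

section LocalRepresentative

variable {P E : Type*} [NormedAddCommGroup P] [NormedSpace ℝ P]
  [NormedAddCommGroup E] [NormedSpace ℝ E]

/-- A strictly differentiable map is Lipschitz near the point, jointly in parameter and variable, so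
one constant serves all parameters near `p₀`. This will bound subgradients locally. -/
theorem eventually_sub_le_of_lipschitzOnWith_comp {Φ : P × E → E} {Φ' : P × E →L[ℝ] E}
    {p₀ : P} (hΦ : HasStrictFDerivAt Φ Φ' (p₀, 0)) {F : E → ℝ} {K : NNReal} {s : Set E}
    (hs : s ∈ 𝓝 (Φ (p₀, 0))) (hF : LipschitzOnWith K F s) :
    ∃ C : ℝ, 0 ≤ C ∧ ∀ᶠ p in 𝓝 p₀, ∀ b : E, ∀ᶠ q : E × ℝ in 𝓝 0 ×ˢ 𝓝[>] (0 : ℝ),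
      F (Φ (p, q.1 + q.2 • b)) - F (Φ (p, q.1)) ≤ C * ‖b‖ * q.2 := by
  obtain ⟨L, W, hW, hL⟩ := hΦ.exists_lipschitzOnWith
  have hW' : W ∩ Φ ⁻¹' s ∈ 𝓝 (p₀, (0 : E)) := inter_mem hW (hΦ.continuousAt hs)
  refine ⟨K * L, by positivity, ?_⟩
  have hcont : Tendsto (fun p : P => (p, (0 : E))) (𝓝 p₀) (𝓝 (p₀, 0)) :=
    (Continuous.prodMk_left (0 : E)).tendsto p₀
  filter_upwards [hcont.eventually (eventually_eventually_nhds.2 hW')] with p hp b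
  have h1 : Tendsto (fun q : E × ℝ => (p, q.1)) (𝓝 0 ×ˢ 𝓝[>] (0 : ℝ)) (𝓝 (p, 0)) :=
    tendsto_const_nhds.prodMk_nhds tendsto_fst
  have h2 : Tendsto (fun q : E × ℝ => (p, q.1 + q.2 • b)) (𝓝 0 ×ˢ 𝓝[>] (0 : ℝ))
      (𝓝 (p, 0)) := by
    have : Tendsto (fun q : E × ℝ => (p, q.1 + q.2 • b)) (𝓝 (0, 0)) (𝓝 (p, 0 + (0 : ℝ) • b)) :=
      Continuous.tendsto (by fun_prop) (0, 0)
    rw [zero_smul, add_zero] at this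
    refine this.mono_left ?_
    rw [nhds_prod_eq]
    exact prod_mono le_rfl nhdsWithin_le_nhds
  have hpos : ∀ᶠ q : E × ℝ in 𝓝 0 ×ˢ 𝓝[>] (0 : ℝ), 0 < q.2 :=
    tendsto_snd.eventually self_mem_nhdsWithin
  filter_upwards [h1.eventually hp, h2.eventually hp, hpos] with q hq1 hq2 hq
  have e1 := hF.dist_le_mul _ hq2.2 _ hq1.2
  have e2 := hL.dist_le_mul _ hq2.1 _ hq1.1
  have e3 : dist (p, q.1 + q.2 • b) (p, q.1) = ‖b‖ * q.2 := by
    rw [dist_prod_same_left, dist_eq_norm, add_sub_cancel_left, norm_smul, Real.norm_eq_abs,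
      abs_of_pos hq, mul_comm]
  rw [e3] at e2
  calc F (Φ (p, q.1 + q.2 • b)) - F (Φ (p, q.1))
      ≤ dist (F (Φ (p, q.1 + q.2 • b))) (F (Φ (p, q.1))) := le_abs_self _
    _ ≤ K * (L * (‖b‖ * q.2)) := e1.trans (by gcongr)
    _ = K * L * ‖b‖ * q.2 := by ring

/-- Upper semicontinuity of generalized directional derivatives, for a family `F ∘ Φ (p, ·)` of
reparametrizations of `F`. -/
theorem eventually_sub_le_neg_of_strictFDerivAt [CompleteSpace E]
    {Φ : P × E → E} {Φ' : P × E →L[ℝ] E} {p₀ : P} {b₀ : E}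
    (hΦ : HasStrictFDerivAt Φ Φ' (p₀, 0)) (hΦ' : ∀ b, Φ' (0, b) = b)
    {F : E → ℝ} {K : NNReal} {s : Set E} (hs : s ∈ 𝓝 (Φ (p₀, 0))) (hF : LipschitzOnWith K F s)
    {c c' : ℝ} (hc : c < c')
    (H : ∀ᶠ q : E × ℝ in 𝓝 0 ×ˢ 𝓝[>] (0 : ℝ),
      F (Φ (p₀, q.1 + q.2 • b₀)) - F (Φ (p₀, q.1)) ≤ c * q.2) :
    ∀ᶠ r : P × E in 𝓝 (p₀, b₀), ∀ᶠ q : E × ℝ in 𝓝 0 ×ˢ 𝓝[>] (0 : ℝ),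
      F (Φ (r.1, q.1 + q.2 • r.2)) - F (Φ (r.1, q.1)) ≤ c' * q.2 := by
  -- `F` is compared with straight segments twice: at the parameter `p₀`, costing `K ε ‖b₀‖`, and at
  -- nearby parameters and directions, costing `K (ε (‖b₀‖ + 1) + ε)`. The total must fit into `c' -
  -- c`.
  obtain ⟨ε, hε0, hε⟩ : ∃ ε : ℝ, 0 < ε ∧ K * (ε * (2 * ‖b₀‖ + 2)) ≤ c' - c := by
    refine ⟨(c' - c) / (K * (2 * ‖b₀‖ + 2) + 1), div_pos (sub_pos.2 hc) (by positivity), ?_⟩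
    have hpos : 0 < K * (2 * ‖b₀‖ + 2) + 1 := by positivity
    rw [div_mul_eq_mul_div, mul_div_assoc', div_le_iff₀ hpos]
    nlinarith [sub_pos.2 hc]
  set l : Filter ((P × E) × (E × ℝ)) := 𝓝 (p₀, b₀) ×ˢ (𝓝 0 ×ˢ 𝓝[>] (0 : ℝ)) with hl
  have hl_le : l ≤ 𝓝 ((p₀, b₀), (0, 0)) := by
    rw [hl, nhds_prod_eq (x := (p₀, b₀)), nhds_prod_eq (x := (0 : E))]
    exact prod_mono le_rfl (prod_mono le_rfl nhdsWithin_le_nhds)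
  have t1 : Tendsto (fun z : (P × E) × (E × ℝ) => (z.1.1, z.2.1 + z.2.2 • z.1.2)) l
      (𝓝 (p₀, 0)) := (Continuous.tendsto' (by fun_prop) _ _ (by simp)).mono_left hl_le
  have t2 : Tendsto (fun z : (P × E) × (E × ℝ) => (z.1.1, z.2.1)) l (𝓝 (p₀, 0)) :=
    (Continuous.tendsto' (by fun_prop) _ _ (by simp)).mono_left hl_le
  have hΦc : ContinuousAt Φ (p₀, 0) := hΦ.continuousAt
  have m1 : ∀ᶠ z in l, Φ (z.1.1, z.2.1 + z.2.2 • z.1.2) ∈ s := (hΦc.tendsto.comp t1).eventually hs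
  have t3 : Tendsto (fun z : (P × E) × (E × ℝ) => Φ (z.1.1, z.2.1) + z.2.2 • b₀) l
      (𝓝 (Φ (p₀, 0))) := by
    have h0 : Tendsto (fun z : (P × E) × (E × ℝ) => z.2.2 • b₀) l (𝓝 0) :=
      (Continuous.tendsto' (by fun_prop) _ _ (by simp)).mono_left hl_le
    simpa using (hΦc.tendsto.comp t2).add h0
  have m3 : ∀ᶠ z in l, Φ (z.1.1, z.2.1) + z.2.2 • b₀ ∈ s := t3.eventually hs
  have hpos : ∀ᶠ z in l, 0 < z.2.2 :=
    (tendsto_snd.comp tendsto_snd).eventually self_mem_nhdsWithin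
  -- Strict differentiability applied to two points with the same parameter: the increment is `t b`
  -- up to a relative error `ε`, uniformly in the parameter and the base point.
  have hsmall : ∀ᶠ z in l, ‖Φ (z.1.1, z.2.1 + z.2.2 • z.1.2) - Φ (z.1.1, z.2.1) - z.2.2 • z.1.2‖
      ≤ ε * (z.2.2 * ‖z.1.2‖) := by
    have h := (t1.prodMk_nhds t2).eventually (hΦ.isLittleO.def hε0)
    filter_upwards [h, hpos] with z hz hz0
    simp only [Prod.mk_sub_mk, sub_self, add_sub_cancel_left, hΦ'] at hz
    rwa [Prod.norm_def, norm_zero, max_eq_right (norm_nonneg _), norm_smul, Real.norm_eq_abs,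
      abs_of_pos hz0] at hz
  -- An estimate for `F` itself, free of the parameter. The derivative of `Φ (p₀, ·)` at `0` is the
  -- identity, hence onto, so all points near `Φ (p₀, 0)` are values of `Φ (p₀, ·)` and `H` reaches
  -- every base point.
  have hbase : ∀ᶠ q : E × ℝ in 𝓝 (Φ (p₀, 0)) ×ˢ 𝓝[>] (0 : ℝ),
      F (q.1 + q.2 • b₀) - F q.1 ≤ (c + K * (ε * ‖b₀‖)) * q.2 := by
    have hd : HasStrictFDerivAt (fun a => Φ (p₀, a))
        (Φ'.comp ((0 : E →L[ℝ] P).prod (ContinuousLinearMap.id ℝ E))) 0 :=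
      hΦ.comp (0 : E) ((hasStrictFDerivAt_const p₀ (0 : E)).prodMk (hasStrictFDerivAt_id 0))
    have hmap := hd.map_nhds_eq_of_surj (by
      rw [LinearMap.range_eq_top]
      exact fun b => ⟨b, by simp [hΦ']⟩)
    rw [← hmap, ← map_id (f := 𝓝[>] (0 : ℝ)), prod_map_map_eq, eventually_map]
    have hι : Tendsto (fun q : E × ℝ => ((p₀, b₀), q)) (𝓝 0 ×ˢ 𝓝[>] (0 : ℝ)) l := by
      rw [hl]
      exact (tendsto_const_nhds).prodMk tendsto_id
    filter_upwards [H, hι.eventually m1, hι.eventually m3, hι.eventually hsmall,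
      hι.eventually hpos] with q hq hq1 hq3 hqs hq0
    have e := hF.dist_le_mul _ hq3 _ hq1
    rw [Real.dist_eq, dist_comm (Φ (p₀, q.1) + q.2 • b₀), dist_eq_norm, ← sub_sub] at e
    have e' := (le_abs_self _).trans (e.trans (mul_le_mul_of_nonneg_left hqs K.2))
    simp only [id] at e' ⊢
    linarith [show K * (ε * (q.2 * ‖b₀‖)) = K * (ε * ‖b₀‖) * q.2 by ring]
  have hlbase : Tendsto (fun z : (P × E) × (E × ℝ) => (Φ (z.1.1, z.2.1), z.2.2)) l
      (𝓝 (Φ (p₀, 0)) ×ˢ 𝓝[>] (0 : ℝ)) :=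
    (hΦc.tendsto.comp t2).prodMk (tendsto_snd.comp tendsto_snd)
  have hb : ∀ᶠ z in l, ‖z.1.2 - b₀‖ < min ε 1 := by
    have : Tendsto (fun z : (P × E) × (E × ℝ) => ‖z.1.2 - b₀‖) l (𝓝 0) :=
      (Continuous.tendsto' (by fun_prop) _ _ (by simp)).mono_left hl_le
    exact this.eventually_lt_const (by positivity)
  have hall : ∀ᶠ z in l, F (Φ (z.1.1, z.2.1 + z.2.2 • z.1.2)) - F (Φ (z.1.1, z.2.1))
      ≤ c' * z.2.2 := by
    filter_upwards [m1, m3, hpos, hsmall, hlbase.eventually hbase, hb]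
      with z h1 h3 h0 hs' hbz hbb
    have e := hF.dist_le_mul _ h1 _ h3
    have e2 : dist (Φ (z.1.1, z.2.1 + z.2.2 • z.1.2)) (Φ (z.1.1, z.2.1) + z.2.2 • b₀)
        ≤ ε * (‖b₀‖ + 1) * z.2.2 + ε * z.2.2 := by
      rw [dist_eq_norm]
      calc ‖Φ (z.1.1, z.2.1 + z.2.2 • z.1.2) - (Φ (z.1.1, z.2.1) + z.2.2 • b₀)‖
          = ‖(Φ (z.1.1, z.2.1 + z.2.2 • z.1.2) - Φ (z.1.1, z.2.1) - z.2.2 • z.1.2)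
              + z.2.2 • (z.1.2 - b₀)‖ := by
            congr 1
            rw [smul_sub]
            abel
        _ ≤ ε * (z.2.2 * ‖z.1.2‖) + z.2.2 * ‖z.1.2 - b₀‖ := by
            refine (norm_add_le _ _).trans (add_le_add hs' ?_)
            rw [norm_smul, Real.norm_eq_abs, abs_of_pos h0]
        _ ≤ ε * (z.2.2 * (‖b₀‖ + 1)) + z.2.2 * ε := by
            have hn : ‖z.1.2‖ ≤ ‖b₀‖ + 1 := by
              have := norm_le_norm_add_norm_sub' z.1.2 b₀
              linarith [min_le_right ε 1]
            have hm : ‖z.1.2 - b₀‖ ≤ ε := hbb.le.trans (min_le_left _ _)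
            gcongr
        _ = _ := by ring
    have e3 := (le_abs_self _).trans (e.trans (mul_le_mul_of_nonneg_left e2 K.2))
    have e4 : K * (ε * (‖b₀‖ + 1) * z.2.2 + ε * z.2.2) + (c + K * (ε * ‖b₀‖)) * z.2.2
        = (K * (ε * (2 * ‖b₀‖ + 2)) + c) * z.2.2 := by ring
    have e5 : (K * (ε * (2 * ‖b₀‖ + 2)) + c) * z.2.2 ≤ c' * z.2.2 := by
      gcongr
      linarith
    linarith
  exact hall.curry

end LocalRepresentative

/-! ### The retraction in tangent bundle coordinates -/

section Coordinates

variable {n : ℕ} {M : Type*} [TopologicalSpace M] [ChartedSpace (EuclideanSpace ℝ (Fin n)) M]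
  [IsManifold (𝓡 n) ∞ M]

/-- The trivialization of the tangent bundle around `x₀`, on the tangent space at `x`. -/
def tangentCoord (x₀ x : M) : TangentSpace (𝓡 n) x →L[ℝ] EuclideanSpace ℝ (Fin n) :=
  (trivializationAt (EuclideanSpace ℝ (Fin n)) (TangentSpace (𝓡 n)) x₀).continuousLinearMapAt ℝ x

/-- The inverse of `tangentCoord x₀ x`, for `x` in the chart domain of `x₀`. -/
def tangentCoordSymm (x₀ x : M) : EuclideanSpace ℝ (Fin n) →L[ℝ] TangentSpace (𝓡 n) x :=
  (trivializationAt (EuclideanSpace ℝ (Fin n)) (TangentSpace (𝓡 n)) x₀).symmL ℝ x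

theorem tangentCoordSymm_tangentCoord {x₀ x : M} (hx : x ∈ (chartAt (EuclideanSpace ℝ (Fin n)) x₀).source)
    (v : TangentSpace (𝓡 n) x) : tangentCoordSymm x₀ x (tangentCoord x₀ x v) = v :=
  Trivialization.symmL_continuousLinearMapAt _ (by simpa using hx) v

theorem tangentCoord_tangentCoordSymm {x₀ x : M} (hx : x ∈ (chartAt (EuclideanSpace ℝ (Fin n)) x₀).source)
    (b : EuclideanSpace ℝ (Fin n)) : tangentCoord x₀ x (tangentCoordSymm x₀ x b) = b :=
  Trivialization.continuousLinearMapAt_symmL _ (by simpa using hx) b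

theorem trivializationAt_mk {x₀ x : M} (hx : x ∈ (chartAt (EuclideanSpace ℝ (Fin n)) x₀).source)
    (v : TangentSpace (𝓡 n) x) :
    trivializationAt (EuclideanSpace ℝ (Fin n)) (TangentSpace (𝓡 n) : M → Type) x₀ ⟨x, v⟩ = (x, tangentCoord x₀ x v) := by
  rw [tangentCoord, Trivialization.continuousLinearMapAt_apply, Trivialization.coe_linearMapAt_of_mem _ (by simpa using hx)]
  rfl

theorem extChartAt_tangent_mk {x₀ x : M} (hx : x ∈ (chartAt (EuclideanSpace ℝ (Fin n)) x₀).source)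
    (v : TangentSpace (𝓡 n) x) :
    extChartAt (𝓡 n).tangent (⟨x₀, 0⟩ : TangentBundle (𝓡 n) M) ⟨x, v⟩
      = (extChartAt (𝓡 n) x₀ x, tangentCoord x₀ x v) := by
  rw [ModelWithCorners.tangent, FiberBundle.extChartAt]
  simp [trivializationAt_mk hx]

/-- The map `R : TM → M` in the coordinates of `TM` around `x₀` and of `M` around `y₀`. -/
def localRep (R : TangentBundle (𝓡 n) M → M) (x₀ y₀ : M) :
    EuclideanSpace ℝ (Fin n) × EuclideanSpace ℝ (Fin n) → EuclideanSpace ℝ (Fin n) :=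
  extChartAt (𝓡 n) y₀ ∘ R ∘
    (extChartAt (𝓡 n).tangent (⟨x₀, 0⟩ : TangentBundle (𝓡 n) M)).symm

theorem localRep_apply (R : TangentBundle (𝓡 n) M → M) {x₀ x : M} (y₀ : M)
    (hx : x ∈ (chartAt (EuclideanSpace ℝ (Fin n)) x₀).source) (v : TangentSpace (𝓡 n) x) :
    localRep R x₀ y₀ (extChartAt (𝓡 n) x₀ x, tangentCoord x₀ x v)
      = extChartAt (𝓡 n) y₀ (R ⟨x, v⟩) := by
  rw [← extChartAt_tangent_mk hx, localRep]
  simp only [Function.comp_apply]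
  rw [PartialEquiv.left_inv]
  rw [ModelWithCorners.tangent, FiberBundle.extChartAt]
  simp [trivializationAt_mk hx, hx]

theorem contDiffAt_localRep {R : TangentBundle (𝓡 n) M → M}
    (hR : ContMDiff (𝓡 n).tangent (𝓡 n) ∞ R) {x₀ y₀ x : M}
    (hx : x ∈ (chartAt (EuclideanSpace ℝ (Fin n)) x₀).source) (v : TangentSpace (𝓡 n) x)
    (hy : R ⟨x, v⟩ ∈ (chartAt (EuclideanSpace ℝ (Fin n)) y₀).source) :
    ContDiffAt ℝ ∞ (localRep R x₀ y₀) (extChartAt (𝓡 n) x₀ x, tangentCoord x₀ x v) := by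
  have h := ((contMDiffAt_iff_of_mem_source (x := (⟨x₀, 0⟩ : TangentBundle (𝓡 n) M))
    (x' := ⟨x, v⟩) (y := y₀) (by simpa using hx) hy).1 (hR _)).2
  rw [extChartAt_tangent_mk hx] at h
  simpa [ModelWithCorners.tangent, contDiffWithinAt_univ] using! h

/-- On one fibre the base coordinate is constant and the fibre coordinate is linear. The variable is
taken in the model space, as in `fiberDeriv`, so that the Riemannian norm plays no role in the
differentiation. -/
theorem hasFDerivAt_extChartAt_comp_retraction {R : TangentBundle (𝓡 n) M → M}
    (hR : ContMDiff (𝓡 n).tangent (𝓡 n) ∞ R) {x₀ y₀ x : M}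
    (hx : x ∈ (chartAt (EuclideanSpace ℝ (Fin n)) x₀).source) (v : EuclideanSpace ℝ (Fin n))
    (hy : R ⟨x, v⟩ ∈ (chartAt (EuclideanSpace ℝ (Fin n)) y₀).source) :
    HasFDerivAt (fun v' : EuclideanSpace ℝ (Fin n) => extChartAt (𝓡 n) y₀ (R ⟨x, v'⟩))
      ((fderiv ℝ (localRep R x₀ y₀) (extChartAt (𝓡 n) x₀ x, tangentCoord x₀ x v)).comp
        ((0 : EuclideanSpace ℝ (Fin n) →L[ℝ] EuclideanSpace ℝ (Fin n)).prod
          (tangentCoord x₀ x : EuclideanSpace ℝ (Fin n) →L[ℝ] EuclideanSpace ℝ (Fin n)))) v := by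
  let A : EuclideanSpace ℝ (Fin n) →L[ℝ] EuclideanSpace ℝ (Fin n) := tangentCoord x₀ x
  have h1 : HasFDerivAt (localRep R x₀ y₀) _ (extChartAt (𝓡 n) x₀ x, A v) :=
    ((contDiffAt_localRep hR hx v hy).differentiableAt (by simp)).hasFDerivAt
  have h2 : HasFDerivAt (fun v' : EuclideanSpace ℝ (Fin n) => (extChartAt (𝓡 n) x₀ x, A v'))
      ((0 : EuclideanSpace ℝ (Fin n) →L[ℝ] EuclideanSpace ℝ (Fin n)).prod A) v :=
    (hasFDerivAt_const _ _).prodMk (ContinuousLinearMap.hasFDerivAt _)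
  refine (h1.comp v h2).congr_of_eventuallyEq (Eventually.of_forall fun v' => ?_)
  exact (localRep_apply R y₀ hx v').symm

/-- The manifold derivative of a chart is the trivialization, so the chain rule applies. The right
side is a partial derivative of one smooth map, hence continuous in base point and vector together.
-/
theorem tangentCoord_fiberDeriv {R : TangentBundle (𝓡 n) M → M}
    (hR : ContMDiff (𝓡 n).tangent (𝓡 n) ∞ R) {x₀ y₀ x : M}
    (hx : x ∈ (chartAt (EuclideanSpace ℝ (Fin n)) x₀).source) (v u : TangentSpace (𝓡 n) x)
    (hy : R ⟨x, v⟩ ∈ (chartAt (EuclideanSpace ℝ (Fin n)) y₀).source) :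
    tangentCoord y₀ (R ⟨x, v⟩) (fiberDeriv R x v u)
      = fderiv ℝ (localRep R x₀ y₀) (extChartAt (𝓡 n) x₀ x, tangentCoord x₀ x v)
          (0, tangentCoord x₀ x u) := by
  have hd := hasFDerivAt_extChartAt_comp_retraction hR hx v hy
  have hcont : Continuous (fun v' : EuclideanSpace ℝ (Fin n) => R ⟨x, v'⟩) :=
    hR.continuous.comp (FiberBundle.continuous_totalSpaceMk (EuclideanSpace ℝ (Fin n))
      (TangentSpace (𝓡 n) : M → Type) x)
  have hm : MDifferentiableAt 𝓘(ℝ, EuclideanSpace ℝ (Fin n)) (𝓡 n)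
      (fun v' : EuclideanSpace ℝ (Fin n) => R ⟨x, v'⟩) v :=
    (mdifferentiableAt_iff_target_of_mem_source (M := EuclideanSpace ℝ (Fin n)) (x := v)
      (f := fun v' : EuclideanSpace ℝ (Fin n) => R ⟨x, v'⟩) (y := y₀) hy).2
      ⟨hcont.continuousAt, hd.differentiableAt.mdifferentiableAt⟩
  have he : MDifferentiableAt (𝓡 n) 𝓘(ℝ, EuclideanSpace ℝ (Fin n)) (extChartAt (𝓡 n) y₀)
      (R ⟨x, v⟩) := mdifferentiableAt_extChartAt hy
  have hc := mfderiv_comp (M := EuclideanSpace ℝ (Fin n)) v he hm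
  rw [← TangentBundle.continuousLinearMapAt_trivializationAt hy] at hc
  exact congrArg (fun L => L u) (hc.symm.trans (mfderiv_eq_fderiv.trans hd.fderiv))

theorem fderiv_localRep_zero {R : TangentBundle (𝓡 n) M → M} (hR : IsRetraction R) (x₀ : M)
    (b : EuclideanSpace ℝ (Fin n)) :
    fderiv ℝ (localRep R x₀ x₀) (extChartAt (𝓡 n) x₀ x₀, 0) (0, b) = b := by
  have hx : x₀ ∈ (chartAt (EuclideanSpace ℝ (Fin n)) x₀).source := mem_chart_source _ x₀
  have hy : R ⟨x₀, 0⟩ ∈ (chartAt (EuclideanSpace ℝ (Fin n)) x₀).source := by rwa [hR.map_zero]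
  have h := tangentCoord_fiberDeriv hR.smooth hx 0 (tangentCoordSymm x₀ x₀ b) hy
  rw [map_zero, tangentCoord_tangentCoordSymm hx] at h
  rw [← h]
  -- `tangentCoord` is applied as a function on the whole tangent bundle, which avoids a cast along
  -- `R ⟨x₀, 0⟩ = x₀`.
  have h2 := congrArg (fun p : TangentBundle (𝓡 n) M => tangentCoord x₀ p.1 p.2)
    (hR.deriv_zero x₀ (tangentCoordSymm x₀ x₀ b))
  exact h2.trans (tangentCoord_tangentCoordSymm hx b)

theorem hasStrictFDerivAt_localRep {R : TangentBundle (𝓡 n) M → M} (hR : IsRetraction R) (x₀ : M) :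
    HasStrictFDerivAt (localRep R x₀ x₀)
      (fderiv ℝ (localRep R x₀ x₀) (extChartAt (𝓡 n) x₀ x₀, 0)) (extChartAt (𝓡 n) x₀ x₀, 0) := by
  have hx : x₀ ∈ (chartAt (EuclideanSpace ℝ (Fin n)) x₀).source := mem_chart_source _ x₀
  have h := contDiffAt_localRep hR.smooth hx 0 (y₀ := x₀) (by rwa [hR.map_zero])
  rw [map_zero] at h
  exact h.hasStrictFDerivAt (by simp)

end Coordinates

/-! ### Convergence in the tangent bundle -/

section TotalSpaceTopology

variable {n : ℕ} {M : Type*} [TopologicalSpace M] [ChartedSpace (EuclideanSpace ℝ (Fin n)) M]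

theorem eventually_mem_chartAt_source (x₀ : M) :
    ∀ᶠ x in 𝓝 x₀, x ∈ (chartAt (EuclideanSpace ℝ (Fin n)) x₀).source :=
  (chartAt (EuclideanSpace ℝ (Fin n)) x₀).open_source.mem_nhds (mem_chart_source _ x₀)

variable [IsManifold (𝓡 n) ∞ M]

theorem tendsto_proj_nhds (p₀ : TangentBundle (𝓡 n) M) :
    Tendsto (fun p : TangentBundle (𝓡 n) M => p.1) (𝓝 p₀) (𝓝 p₀.1) :=
  (FiberBundle.continuous_proj (EuclideanSpace ℝ (Fin n))
    (TangentSpace (𝓡 n) : M → Type)).tendsto p₀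

theorem tendsto_coordinates (p₀ : TangentBundle (𝓡 n) M) :
    Tendsto (fun p : TangentBundle (𝓡 n) M =>
        (extChartAt (𝓡 n) p₀.1 p.1, tangentCoord p₀.1 p.1 p.2)) (𝓝 p₀)
      (𝓝 (extChartAt (𝓡 n) p₀.1 p₀.1, tangentCoord p₀.1 p₀.1 p₀.2)) := by
  have h : ContinuousAt (extChartAt (𝓡 n).tangent (⟨p₀.1, 0⟩ : TangentBundle (𝓡 n) M)) p₀ :=
    continuousAt_extChartAt' (by simp)
  rw [ContinuousAt, extChartAt_tangent_mk (mem_chart_source _ _) p₀.2] at h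
  refine h.congr' ?_
  filter_upwards [(tendsto_proj_nhds p₀).eventually (eventually_mem_chartAt_source (n := n) p₀.1)] with p hp
  exact extChartAt_tangent_mk hp p.2

theorem tendsto_mk_tangentCoordSymm (x₀ : M) (b₀ : EuclideanSpace ℝ (Fin n)) :
    Tendsto (fun q : M × EuclideanSpace ℝ (Fin n) =>
        (⟨q.1, tangentCoordSymm x₀ q.1 q.2⟩ : TangentBundle (𝓡 n) M)) (𝓝 (x₀, b₀))
      (𝓝 ⟨x₀, tangentCoordSymm x₀ x₀ b₀⟩) := by
  set e := trivializationAt (EuclideanSpace ℝ (Fin n)) (TangentSpace (𝓡 n) : M → Type) x₀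
  have key : ∀ x ∈ e.baseSet, ∀ b, e.toOpenPartialHomeomorph.symm (x, b)
      = (⟨x, tangentCoordSymm x₀ x b⟩ : TangentBundle (𝓡 n) M) := fun x hx b =>
    (e.mk_symm hx b).symm.trans (congrArg (TotalSpace.mk x) (e.symmL_apply (R := ℝ) hx b).symm)
  have hb : x₀ ∈ e.baseSet := FiberBundle.mem_baseSet_trivializationAt' x₀
  have h : ContinuousAt e.toOpenPartialHomeomorph.symm (x₀, b₀) :=
    e.toOpenPartialHomeomorph.symm.continuousAt (by simpa [e.mem_target] using hb)
  rw [ContinuousAt, key x₀ hb] at h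
  refine h.congr' ?_
  have := (continuous_fst.tendsto (x₀, b₀)).eventually (e.open_baseSet.mem_nhds hb)
  filter_upwards [this] with q hq
  exact key q.1 hq q.2

end TotalSpaceTopology

/-! ### Comparison of norms, and local bounds for `β⁻¹` -/

section RiemannianBounds

variable {n : ℕ} {M : Type*} [TopologicalSpace M] [ChartedSpace (EuclideanSpace ℝ (Fin n)) M]
  [IsManifold (𝓡 n) ∞ M] [RiemannianBundle (fun x : M => TangentSpace (𝓡 n) x)]
  [IsContinuousRiemannianBundle (EuclideanSpace ℝ (Fin n)) (fun x : M => TangentSpace (𝓡 n) x)]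

/-- Near `x₀` the Riemannian norms are equivalent to the Euclidean norm in the trivialization. -/
theorem eventually_norm_tangentCoord_le (x₀ : M) :
    ∃ C : ℝ, 0 < C ∧ ∀ᶠ x in 𝓝 x₀, x ∈ (chartAt (EuclideanSpace ℝ (Fin n)) x₀).source ∧
      (∀ v : TangentSpace (𝓡 n) x, ‖tangentCoord x₀ x v‖ ≤ C * ‖v‖ ∧
        ‖v‖ ≤ C * ‖tangentCoord x₀ x v‖) ∧
      ∀ b : EuclideanSpace ℝ (Fin n), ‖tangentCoordSymm x₀ x b‖ ≤ C * ‖b‖ := by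
  obtain ⟨C₁, h₁, H₁⟩ := eventually_norm_trivializationAt_lt (EuclideanSpace ℝ (Fin n))
    (fun x : M => TangentSpace (𝓡 n) x) x₀
  obtain ⟨C₂, h₂, H₂⟩ := eventually_norm_symmL_trivializationAt_lt (EuclideanSpace ℝ (Fin n))
    (fun x : M => TangentSpace (𝓡 n) x) x₀
  refine ⟨max C₁ C₂, by positivity, ?_⟩
  filter_upwards [H₁, H₂, eventually_mem_chartAt_source (n := n) x₀] with x hx₁ hx₂ hx
  have hs : ∀ b : EuclideanSpace ℝ (Fin n), ‖tangentCoordSymm x₀ x b‖ ≤ max C₁ C₂ * ‖b‖ := fun b =>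
    ((trivializationAt (EuclideanSpace ℝ (Fin n)) (fun x : M => TangentSpace (𝓡 n) x)
      x₀).symmL ℝ x).le_of_opNorm_le (hx₂.le.trans (le_max_right _ _)) b
  refine ⟨hx, fun v => ⟨?_, ?_⟩, hs⟩
  · exact ((trivializationAt (EuclideanSpace ℝ (Fin n)) (fun x : M => TangentSpace (𝓡 n) x)
      x₀).continuousLinearMapAt ℝ x).le_of_opNorm_le (hx₁.le.trans (le_max_left _ _)) v
  · conv_lhs => rw [← tangentCoordSymm_tangentCoord hx v]
    exact hs _

/-- The quotient `‖D R_x(ξ)[ξ]‖ / ‖ξ‖` is at most an operator norm, and that is locally bounded by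
continuity of the derivative and equivalence of norms. The same bound works at `ξ = 0`, where the
convention gives `1`. -/
theorem eventually_betaInv_le {R : TangentBundle (𝓡 n) M → M}
    (hR : ContMDiff (𝓡 n).tangent (𝓡 n) ∞ R) (p₀ : TangentBundle (𝓡 n) M) :
    ∃ C : ℝ, ∀ᶠ p in 𝓝 p₀, betaInv R p.1 p.2 ≤ C := by
  obtain ⟨C₁, hC₁, H₁⟩ := eventually_norm_tangentCoord_le (n := n) p₀.1
  obtain ⟨C₂, hC₂, H₂⟩ := eventually_norm_tangentCoord_le (n := n) (R p₀)
  have hcd := (contDiffAt_localRep hR (mem_chart_source _ p₀.1) p₀.2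
    (mem_chart_source (EuclideanSpace ℝ (Fin n)) (R p₀))).continuousAt_fderiv (by simp)
  have hD := (hcd.norm.tendsto.comp (tendsto_coordinates p₀)).eventually_lt_const
    (lt_add_one _)
  refine ⟨max 1 (C₂ * ((‖fderiv ℝ (localRep R p₀.1 (R p₀))
    (extChartAt (𝓡 n) p₀.1 p₀.1, tangentCoord p₀.1 p₀.1 p₀.2)‖ + 1) * C₁)), ?_⟩
  filter_upwards [(tendsto_proj_nhds p₀).eventually H₁, hR.continuous.continuousAt.eventually H₂, hD]
    with p h₁ h₂ hDp
  unfold betaInv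
  split_ifs with h0
  · exact le_max_left _ _
  refine le_trans ?_ (le_max_right _ _)
  rw [div_le_iff₀ (norm_pos_iff.2 h0)]
  refine ((h₂.2.1 _).2).trans ?_
  rw [mul_assoc]
  refine mul_le_mul_of_nonneg_left ?_ hC₂.le
  rw [tangentCoord_fiberDeriv hR h₁.1 p.2 p.2 h₂.1, mul_assoc]
  refine (ContinuousLinearMap.le_of_opNorm_le _ hDp.le _).trans ?_
  refine mul_le_mul_of_nonneg_left ?_ (by positivity)
  rw [Prod.norm_def, norm_zero, max_eq_right (norm_nonneg _)]
  exact (h₁.2.1 _).1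

theorem eventually_le_betaInv {R : TangentBundle (𝓡 n) M → M} (hR : IsRetraction R) (x₀ : M) :
    ∃ c : ℝ, 0 < c ∧ ∀ᶠ p : TangentBundle (𝓡 n) M in 𝓝 ⟨x₀, 0⟩, c ≤ betaInv R p.1 p.2 := by
  obtain ⟨C, hC, H⟩ := eventually_norm_tangentCoord_le (n := n) x₀
  have hx : x₀ ∈ (chartAt (EuclideanSpace ℝ (Fin n)) x₀).source := mem_chart_source _ x₀
  have hcd := (contDiffAt_localRep hR.smooth hx 0 (y₀ := x₀)
    (by rwa [hR.map_zero])).continuousAt_fderiv (by simp)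
  have hD := ((hcd.tendsto.comp (tendsto_coordinates (⟨x₀, 0⟩ : TangentBundle (𝓡 n) M))).sub_const
    (fderiv ℝ (localRep R x₀ x₀) (extChartAt (𝓡 n) x₀ x₀, 0))).norm
  rw [map_zero, sub_self, norm_zero] at hD
  have hRt : Tendsto R (𝓝 ⟨x₀, 0⟩) (𝓝 x₀) := by
    have := hR.smooth.continuous.tendsto (⟨x₀, 0⟩ : TangentBundle (𝓡 n) M)
    rwa [hR.map_zero] at this
  -- Near the zero section the derivative is within `1 / 2` of the identity in the fibre direction,
  -- so in coordinates it at most halves `ξ`; the two changes of norm cost a factor `C` each.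
  refine ⟨min 1 (1 / (2 * C * C)), by positivity, ?_⟩
  filter_upwards [(tendsto_proj_nhds (⟨x₀, 0⟩ : TangentBundle (𝓡 n) M)).eventually H,
    hRt.eventually H, hD.eventually_lt_const (show (0 : ℝ) < 1 / 2 by norm_num)] with p h₁ h₂ hDp
  unfold betaInv
  split_ifs with h0
  · exact min_le_left _ _
  refine (min_le_right _ _).trans ?_
  have h0' : 0 < ‖p.2‖ := norm_pos_iff.2 h0
  rw [le_div_iff₀ h0', div_mul_eq_mul_div, one_mul, div_le_iff₀ (by positivity)]
  have e1 := (h₂.2.1 (fiberDeriv R p.1 p.2 p.2)).1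
  rw [tangentCoord_fiberDeriv hR.smooth h₁.1 p.2 p.2 h₂.1] at e1
  have e2 := ContinuousLinearMap.le_of_opNorm_le _ hDp.le
    ((0, tangentCoord x₀ p.1 p.2) : EuclideanSpace ℝ (Fin n) × EuclideanSpace ℝ (Fin n))
  rw [Prod.norm_def, norm_zero, max_eq_right (norm_nonneg _), sub_apply,
    fderiv_localRep_zero hR] at e2
  simp only [Function.comp_apply] at e2
  have e3 := norm_sub_norm_le (tangentCoord x₀ p.1 p.2) (fderiv ℝ (localRep R x₀ x₀)
    (extChartAt (𝓡 n) x₀ p.1, tangentCoord x₀ p.1 p.2) (0, tangentCoord x₀ p.1 p.2))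
  rw [norm_sub_rev] at e3
  have e4 := (h₁.2.1 p.2).2
  nlinarith [norm_nonneg (fiberDeriv R p.1 p.2 p.2)]

end RiemannianBounds

/-! ### Inverse charts and the Riemannian distance -/

section RiemannianDistance

open Manifold Metric

variable {n : ℕ} {M : Type*} [TopologicalSpace M] [ChartedSpace (EuclideanSpace ℝ (Fin n)) M]
  [IsManifold (𝓡 n) ∞ M] [RiemannianBundle (fun x : M => TangentSpace (𝓡 n) x)]
  [IsContinuousRiemannianBundle (EuclideanSpace ℝ (Fin n)) (fun x : M => TangentSpace (𝓡 n) x)]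

theorem eventually_norm_mfderivWithin_extChartAt_symm_le (x : M) :
    ∃ C : NNReal, ∀ᶠ p in 𝓝 (extChartAt (𝓡 n) x x), ∀ b : EuclideanSpace ℝ (Fin n),
      ‖mfderivWithin 𝓘(ℝ, EuclideanSpace ℝ (Fin n)) (𝓡 n) (extChartAt (𝓡 n) x).symm
        (range (𝓡 n)) p b‖ₑ ≤ C * ‖b‖ₑ := by
  obtain ⟨C, hC, H⟩ := eventually_norm_tangentCoord_le (n := n) x
  refine ⟨C.toNNReal, ?_⟩
  have hc : Tendsto (extChartAt (𝓡 n) x).symm (𝓝 (extChartAt (𝓡 n) x x)) (𝓝 x) := by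
    simpa [ContinuousAt] using continuousAt_extChartAt_symm (I := 𝓡 n) x
  filter_upwards [hc.eventually H, extChartAt_target_mem_nhds (I := 𝓡 n) x] with p hp hpt b
  have h := TangentBundle.symmL_trivializationAt (I := 𝓡 n) hp.1
  rw [PartialEquiv.right_inv _ hpt] at h
  rw [← h]
  have h2 := hp.2.2 b
  rw [← ofReal_norm, ← ofReal_norm, ← ENNReal.ofReal_coe_nnreal, Real.coe_toNNReal _ hC.le,
    ← ENNReal.ofReal_mul hC.le]
  exact ENNReal.ofReal_le_ofReal h2

/-- The inverse of a chart is locally Lipschitz for the Riemannian distance. -/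
theorem exists_riemannianEDist_extChartAt_symm_le (x : M) :
    ∃ C : NNReal, ∃ s ∈ 𝓝 (extChartAt (𝓡 n) x x), ∀ p ∈ s, ∀ q ∈ s,
      riemannianEDist (𝓡 n) ((extChartAt (𝓡 n) x).symm p) ((extChartAt (𝓡 n) x).symm q)
        ≤ C * edist p q := by
  obtain ⟨C, hC⟩ := eventually_norm_mfderivWithin_extChartAt_symm_le (n := n) x
  obtain ⟨r, r_pos, hr⟩ := Metric.mem_nhds_iff.1 (inter_mem (extChartAt_target_mem_nhds x) hC)
  refine ⟨C, ball (extChartAt (𝓡 n) x x) r, ball_mem_nhds _ r_pos, fun p hp q hq => ?_⟩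
  -- The distance is at most the length of the image of the Euclidean segment, whose speed is
  -- controlled by the derivative bound because balls are convex.
  let η := ContinuousAffineMap.lineMap (R := ℝ) p q
  set γ := (extChartAt (𝓡 n) x).symm ∘ η
  have hη : ∀ t ∈ Icc (0 : ℝ) 1, η t ∈ ball (extChartAt (𝓡 n) x x) r := fun t ht => by
    refine (convex_ball _ _).segment_subset hp hq ?_
    rw [segment_eq_image_lineMap, ← ContinuousAffineMap.coe_lineMap_eq]
    exact mem_image_of_mem _ ht
  have η_smooth : ContMDiffOn 𝓘(ℝ, ℝ) 𝓘(ℝ, EuclideanSpace ℝ (Fin n)) 1 η (Icc 0 1) := by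
    apply ContMDiff.contMDiffOn
    rw [contMDiff_iff_contDiff]
    exact ContinuousAffineMap.contDiff _
  have : riemannianEDist (𝓡 n) ((extChartAt (𝓡 n) x).symm p) ((extChartAt (𝓡 n) x).symm q)
      ≤ pathELength (𝓡 n) γ 0 1 := by
    apply riemannianEDist_le_pathELength _ _ _ zero_le_one
    · exact (contMDiffOn_extChartAt_symm x).comp η_smooth fun t ht => (hr (hη t ht)).1
    · simp [γ, η, ContinuousAffineMap.coe_lineMap_eq]
    · simp [γ, η, ContinuousAffineMap.coe_lineMap_eq]
  apply this.trans
  rw [← lintegral_fderiv_lineMap_eq_edist, pathELength_eq_lintegral_mfderivWithin_Icc,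
    ← MeasureTheory.lintegral_const_mul' _ _ ENNReal.coe_ne_top]
  apply MeasureTheory.setLIntegral_mono' measurableSet_Icc (fun t ht ↦ ?_)
  have : mfderivWithin 𝓘(ℝ, ℝ) (𝓡 n) γ (Icc 0 1) t =
      (mfderivWithin 𝓘(ℝ, EuclideanSpace ℝ (Fin n)) (𝓡 n) (extChartAt (𝓡 n) x).symm (range (𝓡 n)) (η t)) ∘L
        (mfderivWithin 𝓘(ℝ, ℝ) 𝓘(ℝ, EuclideanSpace ℝ (Fin n)) η (Icc 0 1) t) := by
    apply mfderivWithin_comp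
    · exact mdifferentiableWithinAt_extChartAt_symm (hr (hη t ht)).1
    · exact η_smooth.mdifferentiableOn one_ne_zero t ht
    · exact fun t _ => by simp
    · rw [uniqueMDiffWithinAt_iff_uniqueDiffWithinAt]
      exact uniqueDiffOn_Icc zero_lt_one t ht
  have h1 : mfderivWithin 𝓘(ℝ, ℝ) (𝓡 n) γ (Icc 0 1) t 1 =
      (mfderivWithin 𝓘(ℝ, EuclideanSpace ℝ (Fin n)) (𝓡 n) (extChartAt (𝓡 n) x).symm (range (𝓡 n)) (η t))
        (mfderivWithin 𝓘(ℝ, ℝ) 𝓘(ℝ, EuclideanSpace ℝ (Fin n)) η (Icc 0 1) t 1) := congr($this 1)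
  rw [h1]
  refine ((hr (hη t ht)).2 _).trans ?_
  rw [mfderivWithin_eq_fderivWithin]
  exact le_rfl

end RiemannianDistance

/-! ### Lipschitz functions in charts -/

section LocallyLipschitz

variable {n : ℕ} {M : Type*} [PseudoEMetricSpace M] [ChartedSpace (EuclideanSpace ℝ (Fin n)) M]
  [IsManifold (𝓡 n) ∞ M] [RiemannianBundle (fun x : M => TangentSpace (𝓡 n) x)]
  [IsContinuousRiemannianBundle (EuclideanSpace ℝ (Fin n)) (fun x : M => TangentSpace (𝓡 n) x)]
  [IsRiemannianManifold (𝓡 n) M]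

/-- `LocallyLipschitz` refers to the distance of `M`, the estimates above to the Euclidean one. They
are linked by the identification of the distance with the Riemannian one. -/
theorem exists_lipschitzOnWith_comp_extChartAt_symm {f : M → ℝ} (hf : LocallyLipschitz f) (x : M) :
    ∃ K : NNReal, ∃ s ∈ 𝓝 (extChartAt (𝓡 n) x x),
      LipschitzOnWith K (f ∘ (extChartAt (𝓡 n) x).symm) s := by
  obtain ⟨C, s, hs, H⟩ := exists_riemannianEDist_extChartAt_symm_le (n := n) x
  obtain ⟨K, t, ht, hK⟩ := hf x
  have ht' : (extChartAt (𝓡 n) x).symm ⁻¹' t ∈ 𝓝 (extChartAt (𝓡 n) x x) :=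
    (continuousAt_extChartAt_symm x).preimage_mem_nhds (by rwa [extChartAt_to_inv])
  refine ⟨K * C, s ∩ (extChartAt (𝓡 n) x).symm ⁻¹' t, inter_mem hs ht', ?_⟩
  refine hK.comp (s := s ∩ _) ?_ fun p hp => hp.2
  intro p hp q hq
  rw [IsRiemannianManifold.out (I := 𝓡 n)]
  exact H p hp.1 q hq.1

end LocallyLipschitz

/-! ### Semicontinuity and local boundedness of the Clarke subdifferential -/

section Subdifferential

variable {n : ℕ} {M : Type*} [TopologicalSpace M] [ChartedSpace (EuclideanSpace ℝ (Fin n)) M]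
  [IsManifold (𝓡 n) ∞ M]

theorem eventually_comp_retraction_eq {R : TangentBundle (𝓡 n) M → M} (hR : IsRetraction R)
    (f : M → ℝ) {x₀ y : M} (hy : y ∈ (chartAt (EuclideanSpace ℝ (Fin n)) x₀).source) :
    ∀ᶠ w : TangentSpace (𝓡 n) y in 𝓝 0, f (R ⟨y, w⟩) =
      (f ∘ (extChartAt (𝓡 n) x₀).symm)
        (localRep R x₀ x₀ (extChartAt (𝓡 n) x₀ y, tangentCoord x₀ y w)) := by
  have hcont : Continuous (fun w : TangentSpace (𝓡 n) y => R ⟨y, w⟩) :=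
    hR.smooth.continuous.comp (FiberBundle.continuous_totalSpaceMk (EuclideanSpace ℝ (Fin n))
      (TangentSpace (𝓡 n) : M → Type) y)
  have h0 : (chartAt (EuclideanSpace ℝ (Fin n)) x₀).source ∈ 𝓝 (R ⟨y, 0⟩) := by
    rw [hR.map_zero]
    exact (chartAt _ x₀).open_source.mem_nhds hy
  filter_upwards [hcont.continuousAt.preimage_mem_nhds h0] with w hw
  rw [localRep_apply R x₀ hy w, Function.comp_apply, PartialEquiv.left_inv]
  simpa using hw

variable [RiemannianBundle (fun x : M => TangentSpace (𝓡 n) x)]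

/-- `tangentCoord x₀ y` is a continuous linear change of variables fixing `0`, so an estimate in the
coordinates of one chart bounds the Clarke derivative in the fibre over any `y` in that chart. -/
theorem inner_le_of_mem_clarkeSubdiff {R : TangentBundle (𝓡 n) M → M} (hR : IsRetraction R)
    {f : M → ℝ} {x₀ y : M} (hy : y ∈ (chartAt (EuclideanSpace ℝ (Fin n)) x₀).source)
    {g : TangentSpace (𝓡 n) y} (hg : g ∈ clarkeSubdiff R f y) {v : TangentSpace (𝓡 n) y} {c : ℝ}
    (H : ∀ᶠ q : EuclideanSpace ℝ (Fin n) × ℝ in 𝓝 0 ×ˢ 𝓝[>] (0 : ℝ),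
      (f ∘ (extChartAt (𝓡 n) x₀).symm) (localRep R x₀ x₀
          (extChartAt (𝓡 n) x₀ y, q.1 + q.2 • tangentCoord x₀ y v)) -
        (f ∘ (extChartAt (𝓡 n) x₀).symm) (localRep R x₀ x₀ (extChartAt (𝓡 n) x₀ y, q.1))
        ≤ c * q.2) :
    inner ℝ g v ≤ c := by
  refine EReal.coe_le_coe_iff.1 ((hg v).trans (clarkeDeriv_le_of_eventually ?_))
  have hl : 𝓝 (0 : TangentSpace (𝓡 n) y) ×ˢ 𝓝[>] (0 : ℝ) ≤ 𝓝 (0, 0) := by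
    rw [nhds_prod_eq]
    exact prod_mono le_rfl nhdsWithin_le_nhds
  have t0 : Tendsto (fun q : TangentSpace (𝓡 n) y × ℝ => (tangentCoord x₀ y q.1, q.2))
      (𝓝 0 ×ˢ 𝓝[>] (0 : ℝ)) (𝓝 0 ×ˢ 𝓝[>] (0 : ℝ)) :=
    ((tangentCoord (n := n) x₀ y).continuous.tendsto' 0 0 (map_zero _)).prodMap tendsto_id
  have t2 : Tendsto (fun q : TangentSpace (𝓡 n) y × ℝ => q.1 + q.2 • v)
      (𝓝 0 ×ˢ 𝓝[>] (0 : ℝ)) (𝓝 0) :=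
    (Continuous.tendsto' (by fun_prop) _ _ (by simp)).mono_left hl
  filter_upwards [t0.eventually H,
    tendsto_fst.eventually (eventually_comp_retraction_eq hR f hy),
    t2.eventually (eventually_comp_retraction_eq hR f hy)] with q h h1 h2
  rw [h1, h2, map_add, map_smul]
  exact h

/-- Upper semicontinuity of the Clarke subdifferential, at a point that is not stationary. -/
theorem exists_eventually_inner_le_neg {R : TangentBundle (𝓡 n) M → M}
    (hR : IsRetraction R) {f : M → ℝ} {x₀ : M} {K : NNReal} {s : Set (EuclideanSpace ℝ (Fin n))}
    (hs : s ∈ 𝓝 (extChartAt (𝓡 n) x₀ x₀))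
    (hf : LipschitzOnWith K (f ∘ (extChartAt (𝓡 n) x₀).symm) s)
    (h0 : (0 : TangentSpace (𝓡 n) x₀) ∉ clarkeSubdiff R f x₀) :
    ∃ (b : EuclideanSpace ℝ (Fin n)) (c : ℝ), 0 < c ∧
      ∀ᶠ p : TangentBundle (𝓡 n) M in 𝓝 ⟨x₀, tangentCoordSymm x₀ x₀ b⟩,
        ∀ g ∈ clarkeSubdiff R f p.1, inner ℝ g p.2 ≤ -c := by
  have hx₀ : x₀ ∈ (chartAt (EuclideanSpace ℝ (Fin n)) x₀).source := mem_chart_source _ x₀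
  have hΦ0 : localRep R x₀ x₀ (extChartAt (𝓡 n) x₀ x₀, 0) = extChartAt (𝓡 n) x₀ x₀ := by
    have h := localRep_apply R x₀ hx₀ 0
    rwa [map_zero, hR.map_zero] at h
  obtain ⟨d, hd⟩ : ∃ d : TangentSpace (𝓡 n) x₀,
      clarkeDeriv (fun v : TangentSpace (𝓡 n) x₀ => f (R ⟨x₀, v⟩)) 0 d < 0 := by
    simpa [clarkeSubdiff, clarkeSubdiffVec] using h0
  obtain ⟨c', hc', hc0⟩ := EReal.lt_iff_exists_real_btwn.1 hd
  have hc0' : c' < 0 := by exact_mod_cast hc0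
  have H := eventually_of_clarkeDeriv_lt hc'
  set b := tangentCoord x₀ x₀ d with hb
  have hbd : tangentCoordSymm x₀ x₀ b = d := tangentCoordSymm_tangentCoord hx₀ d
  refine ⟨b, -c' / 2, by linarith, ?_⟩
  have H' : ∀ᶠ q : EuclideanSpace ℝ (Fin n) × ℝ in 𝓝 0 ×ˢ 𝓝[>] (0 : ℝ),
      (f ∘ (extChartAt (𝓡 n) x₀).symm) (localRep R x₀ x₀
          (extChartAt (𝓡 n) x₀ x₀, q.1 + q.2 • b)) -
        (f ∘ (extChartAt (𝓡 n) x₀).symm) (localRep R x₀ x₀ (extChartAt (𝓡 n) x₀ x₀, q.1))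
        ≤ c' * q.2 := by
    have hl : 𝓝 (0 : EuclideanSpace ℝ (Fin n)) ×ˢ 𝓝[>] (0 : ℝ) ≤ 𝓝 (0, 0) := by
      rw [nhds_prod_eq]
      exact prod_mono le_rfl nhdsWithin_le_nhds
    have ts := (tangentCoordSymm x₀ x₀ :
      EuclideanSpace ℝ (Fin n) →L[ℝ] TangentSpace (𝓡 n) x₀).continuous.tendsto' 0 0 (map_zero _)
    have t0 : Tendsto (fun q : EuclideanSpace ℝ (Fin n) × ℝ => (tangentCoordSymm x₀ x₀ q.1, q.2))
      (𝓝 0 ×ˢ 𝓝[>] (0 : ℝ)) (𝓝 0 ×ˢ 𝓝[>] (0 : ℝ)) := ts.prodMap tendsto_id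
    have t1 : Tendsto (fun q : EuclideanSpace ℝ (Fin n) × ℝ => tangentCoordSymm x₀ x₀ q.1)
      (𝓝 0 ×ˢ 𝓝[>] (0 : ℝ)) (𝓝 0) := ts.comp tendsto_fst
    have t2 : Tendsto (fun q : EuclideanSpace ℝ (Fin n) × ℝ =>
        tangentCoordSymm x₀ x₀ (q.1 + q.2 • b)) (𝓝 0 ×ˢ 𝓝[>] (0 : ℝ)) (𝓝 0) :=
      ts.comp ((Continuous.tendsto' (by fun_prop) _ _ (by simp)).mono_left hl)
    filter_upwards [t0.eventually H,
      t1.eventually (eventually_comp_retraction_eq hR f hx₀),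
      t2.eventually (eventually_comp_retraction_eq hR f hx₀)] with q h h1 h2
    rw [tangentCoord_tangentCoordSymm hx₀] at h1 h2
    rw [← h1, ← h2, map_add, map_smul, hbd]
    exact h
  -- Half of the negative number `c'` is given up as the slack that upper semicontinuity needs.
  have husc := eventually_sub_le_neg_of_strictFDerivAt (c' := c' / 2)
    (hasStrictFDerivAt_localRep hR x₀) (fderiv_localRep_zero hR x₀) (by rwa [hΦ0]) hf
    (by linarith) H'
  have ht := tendsto_coordinates (⟨x₀, d⟩ : TangentBundle (𝓡 n) M)
  rw [hbd]
  filter_upwards [ht.eventually husc, (tendsto_proj_nhds (⟨x₀, d⟩ : TangentBundle (𝓡 n) M)).eventually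
    (eventually_mem_chartAt_source (n := n) x₀)] with p hp hps g hg
  rw [neg_div, neg_neg]
  exact inner_le_of_mem_clarkeSubdiff hR hps hg hp

variable [IsContinuousRiemannianBundle (EuclideanSpace ℝ (Fin n))
  (fun x : M => TangentSpace (𝓡 n) x)]

/-- Subgradients of a locally Lipschitz function are locally bounded. -/
theorem eventually_norm_le_of_mem_clarkeSubdiff {R : TangentBundle (𝓡 n) M → M}
    (hR : IsRetraction R) {f : M → ℝ} {x₀ : M} {K : NNReal} {s : Set (EuclideanSpace ℝ (Fin n))}
    (hs : s ∈ 𝓝 (extChartAt (𝓡 n) x₀ x₀))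
    (hf : LipschitzOnWith K (f ∘ (extChartAt (𝓡 n) x₀).symm) s) :
    ∃ C : ℝ, 0 ≤ C ∧ ∀ᶠ y in 𝓝 x₀, ∀ g ∈ clarkeSubdiff R f y, ‖g‖ ≤ C := by
  have hΦ0 : localRep R x₀ x₀ (extChartAt (𝓡 n) x₀ x₀, 0) = extChartAt (𝓡 n) x₀ x₀ := by
    have h := localRep_apply R x₀ (mem_chart_source _ x₀) 0
    rwa [map_zero, hR.map_zero] at h
  obtain ⟨C, hC, H⟩ := eventually_sub_le_of_lipschitzOnWith_comp
    (hasStrictFDerivAt_localRep hR x₀) (by rwa [hΦ0]) hf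
  obtain ⟨C₁, hC₁, H₁⟩ := eventually_norm_tangentCoord_le (n := n) x₀
  refine ⟨C * C₁, by positivity, ?_⟩
  filter_upwards [(continuousAt_extChartAt (I := 𝓡 n) x₀).eventually H, H₁] with y hy h₁ g hg
  -- The subgradient is tested against itself, giving `‖g‖ ^ 2 ≤ C * C₁ * ‖g‖`.
  have h := inner_le_of_mem_clarkeSubdiff hR h₁.1 hg (hy (tangentCoord x₀ y g))
  rw [real_inner_self_eq_norm_sq] at h
  by_contra! hlt
  have hg0 : 0 < ‖g‖ := lt_of_le_of_lt (by positivity) hlt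
  have h2 := mul_le_mul_of_nonneg_left (h₁.2.1 g).1 hC
  nlinarith

end Subdifferential

/-! ### From neighbourhoods in the tangent bundle to balls in the fibres -/

section FiberBalls

variable {n : ℕ} {M : Type*} [TopologicalSpace M] [ChartedSpace (EuclideanSpace ℝ (Fin n)) M]
  [IsManifold (𝓡 n) ∞ M] [RiemannianBundle (fun x : M => TangentSpace (𝓡 n) x)]
  [IsContinuousRiemannianBundle (EuclideanSpace ℝ (Fin n)) (fun x : M => TangentSpace (𝓡 n) x)]

theorem eventually_forall_norm_lt {Q : TangentBundle (𝓡 n) M → Prop} {x₀ : M}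
    (hQ : ∀ᶠ p in 𝓝 (⟨x₀, 0⟩ : TangentBundle (𝓡 n) M), Q p) :
    ∃ r : ℝ, 0 < r ∧ ∀ᶠ x in 𝓝 x₀, ∀ η : TangentSpace (𝓡 n) x, ‖η‖ < r → Q ⟨x, η⟩ := by
  obtain ⟨C, hC, H⟩ := eventually_norm_tangentCoord_le (n := n) x₀
  have ht := tendsto_mk_tangentCoordSymm (n := n) x₀ 0
  rw [map_zero, nhds_prod_eq] at ht
  obtain ⟨pa, hpa, pb, hpb, hab⟩ := eventually_prod_iff.1 (ht.eventually hQ)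
  obtain ⟨δ, hδ, hball⟩ := Metric.eventually_nhds_iff_ball.1 hpb
  refine ⟨δ / C, by positivity, ?_⟩
  filter_upwards [H, hpa] with x hx hxa η hη
  have h := hab hxa (hball (tangentCoord x₀ x η) ?_)
  · rwa [tangentCoordSymm_tangentCoord hx.1] at h
  · rw [mem_ball_zero_iff]
    rw [lt_div_iff₀ hC, mul_comm] at hη
    exact (hx.2.1 η).1.trans_lt hη

/-- Local bounds on the tangent bundle are uniform over bounded balls of the tangent spaces at
the points near `x₀`. -/
theorem exists_eventually_forall_norm_le {Q : ℝ → TangentBundle (𝓡 n) M → Prop}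
    (hmono : ∀ C C' p, C ≤ C' → Q C p → Q C' p)
    (hQ : ∀ p₀, ∃ C, ∀ᶠ p in 𝓝 p₀, Q C p) (x₀ : M) (r : ℝ) :
    ∃ C, ∀ᶠ x in 𝓝 x₀, ∀ η : TangentSpace (𝓡 n) x, ‖η‖ ≤ r → Q C ⟨x, η⟩ := by
  obtain ⟨C₁, hC₁, H⟩ := eventually_norm_tangentCoord_le (n := n) x₀
  obtain ⟨C, hC⟩ : ∃ C, ∀ᶠ x in 𝓝 x₀,
      ∀ b ∈ Metric.closedBall (0 : EuclideanSpace ℝ (Fin n)) (C₁ * r),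
        Q C ⟨x, tangentCoordSymm x₀ x b⟩ := by
    -- Compactness of the ball of coordinates leaves finitely many local constants, and `hmono`
    -- allows passing to their maximum.
    refine (isCompact_closedBall (0 : EuclideanSpace ℝ (Fin n)) (C₁ * r)).induction_on
      (p := fun s => ∃ C, ∀ᶠ x in 𝓝 x₀, ∀ b ∈ s, Q C ⟨x, tangentCoordSymm x₀ x b⟩)
      ⟨0, by simp⟩ ?_ ?_ ?_
    · rintro s t hst ⟨C, hC⟩
      exact ⟨C, hC.mono fun x hx b hb => hx b (hst hb)⟩
    · rintro s t ⟨C, hC⟩ ⟨C', hC'⟩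
      refine ⟨max C C', ?_⟩
      filter_upwards [hC, hC'] with x hx hx' b hb
      rcases hb with hb | hb
      · exact hmono _ _ _ (le_max_left _ _) (hx b hb)
      · exact hmono _ _ _ (le_max_right _ _) (hx' b hb)
    · intro b₀ _
      obtain ⟨C, hC⟩ := hQ ⟨x₀, tangentCoordSymm x₀ x₀ b₀⟩
      have ht := (tendsto_mk_tangentCoordSymm (n := n) x₀ b₀).eventually hC
      rw [nhds_prod_eq] at ht
      obtain ⟨pa, hpa, pb, hpb, hab⟩ := eventually_prod_iff.1 ht
      exact ⟨{b | pb b}, mem_nhdsWithin_of_mem_nhds hpb, C, hpa.mono fun x hx b hb => hab hx hb⟩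
  refine ⟨C, ?_⟩
  filter_upwards [H, hC] with x hx hxC η hη
  have h := hxC (tangentCoord x₀ x η) (by
    rw [mem_closedBall_zero_iff]
    exact (hx.2.1 η).1.trans (mul_le_mul_of_nonneg_left hη hC₁.le))
  rwa [tangentCoordSymm_tangentCoord hx.1] at h

end FiberBalls

/-! ### Transported subgradients -/

section Transport

variable {n : ℕ} {M : Type*} [TopologicalSpace M] [ChartedSpace (EuclideanSpace ℝ (Fin n)) M]

theorem betaInv_nonneg [RiemannianBundle (fun x : M => TangentSpace (𝓡 n) x)]
    (R : TangentBundle (𝓡 n) M → M) (x : M) (ξ : TangentSpace (𝓡 n) x) :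
    0 ≤ betaInv R x ξ := by
  unfold betaInv
  split_ifs <;> positivity

variable [IsManifold (𝓡 n) ∞ M]

/-- Vectors with constant coordinates, even after transport along a small `η`, stay near the
original vector at `x₀` since `T_0` is the identity. Semicontinuity can thus be applied at the trial
point `R_x(η)`. -/
theorem VectorTransport.tendsto_map_tangentCoordSymm {R : TangentBundle (𝓡 n) M → M}
    (T : VectorTransport R) (x₀ : M) (b : EuclideanSpace ℝ (Fin n)) :
    Tendsto (fun p : TangentBundle (𝓡 n) M =>
        (⟨R p, T.map p.1 p.2 (tangentCoordSymm x₀ p.1 b)⟩ : TangentBundle (𝓡 n) M))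
      (𝓝 ⟨x₀, 0⟩) (𝓝 ⟨x₀, tangentCoordSymm x₀ x₀ b⟩) := by
  let q : TangentBundle (𝓡 n) M →
      TotalSpace (EuclideanSpace ℝ (Fin n) × EuclideanSpace ℝ (Fin n))
        ((TangentSpace (𝓡 n) : M → Type) ×ᵇ (TangentSpace (𝓡 n) : M → Type)) :=
    fun p => ⟨p.1, (p.2, tangentCoordSymm x₀ p.1 b)⟩
  have hq : ContinuousAt q ⟨x₀, 0⟩ := by
    rw [(FiberBundle.Prod.isInducing_diag (EuclideanSpace ℝ (Fin n))
      (TangentSpace (𝓡 n) : M → Type) (EuclideanSpace ℝ (Fin n))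
      (TangentSpace (𝓡 n) : M → Type)).continuousAt_iff]
    refine ContinuousAt.prodMk continuousAt_id ?_
    exact (tendsto_mk_tangentCoordSymm (n := n) x₀ b).comp
      ((tendsto_proj_nhds (⟨x₀, 0⟩ : TangentBundle (𝓡 n) M)).prodMk_nhds tendsto_const_nhds)
  have h := (T.continuous_map.tendsto (q ⟨x₀, 0⟩)).comp hq
  have e := T.map_zero x₀ (tangentCoordSymm x₀ x₀ b)
  rw [← e]
  exact h

variable [RiemannianBundle (fun x : M => TangentSpace (𝓡 n) x)]

/-- The inverse of an isometry is its adjoint; this moves the transport from the subgradient to the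
test vector. -/
theorem VectorTransport.IsIsometric.inner_symm {R : TangentBundle (𝓡 n) M → M}
    {T : VectorTransport R} (hT : T.IsIsometric) (x : M) (η : TangentSpace (𝓡 n) x)
    (g : TangentSpace (𝓡 n) (R ⟨x, η⟩)) (v : TangentSpace (𝓡 n) x) :
    inner ℝ ((T.map x η).symm g) v = inner ℝ g (T.map x η v) := by
  rw [← hT x η, LinearEquiv.apply_symm_apply]

theorem VectorTransport.IsIsometric.norm_hatBack {R : TangentBundle (𝓡 n) M → M}
    {T : VectorTransport R} (hT : T.IsIsometric) (x : M) (η : TangentSpace (𝓡 n) x)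
    (g : TangentSpace (𝓡 n) (R ⟨x, η⟩)) : ‖T.hatBack x η g‖ = betaInv R x η * ‖g‖ := by
  have h : ‖(T.map x η).symm g‖ = ‖g‖ := by
    rw [norm_eq_sqrt_real_inner, hT.inner_symm, LinearEquiv.apply_symm_apply,
      ← norm_eq_sqrt_real_inner]
  rw [VectorTransport.hatBack, norm_smul, h, Real.norm_of_nonneg (betaInv_nonneg R x η)]

variable [IsContinuousRiemannianBundle (EuclideanSpace ℝ (Fin n))
  (fun x : M => TangentSpace (𝓡 n) x)]

/-- The norm is `β⁻¹ ‖g‖`, and both factors are bounded near each vector of the tangent bundle;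
compactness of fibre balls makes the bound uniform. -/
theorem VectorTransport.IsIsometric.exists_eventually_norm_hatBack_le
    {R : TangentBundle (𝓡 n) M → M} (hR : IsRetraction R)
    {T : VectorTransport R} (hT : T.IsIsometric) {f : M → ℝ}
    (hf : ∀ x : M, ∃ K : NNReal, ∃ s ∈ 𝓝 (extChartAt (𝓡 n) x x),
      LipschitzOnWith K (f ∘ (extChartAt (𝓡 n) x).symm) s) (x₀ : M) (r : ℝ) :
    ∃ C : ℝ, ∀ᶠ x in 𝓝 x₀, ∀ η : TangentSpace (𝓡 n) x, ‖η‖ ≤ r →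
      ∀ g ∈ clarkeSubdiff R f (R ⟨x, η⟩), ‖T.hatBack x η g‖ ≤ C := by
  refine exists_eventually_forall_norm_le
    (Q := fun C p => ∀ g ∈ clarkeSubdiff R f (R p), ‖T.hatBack p.1 p.2 g‖ ≤ C)
    (fun C C' p hC h g hg => (h g hg).trans hC) (fun p₀ => ?_) x₀ r
  obtain ⟨K, s, hs, hK⟩ := hf (R p₀)
  obtain ⟨C₁, hC₁, H₁⟩ := eventually_norm_le_of_mem_clarkeSubdiff hR hs hK
  obtain ⟨C₂, H₂⟩ := eventually_betaInv_le hR.smooth p₀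
  refine ⟨C₂ * C₁, ?_⟩
  filter_upwards [hR.smooth.continuous.continuousAt.eventually H₁, H₂] with p h₁ h₂ g hg
  rw [hT.norm_hatBack]
  exact mul_le_mul h₂ (h₁ g hg) (norm_nonneg _) ((betaInv_nonneg R _ _).trans h₂)

/-- Near a point `x₀` that is not stationary, all subgradients at points near `x₀`, transported
to tangent spaces near `x₀`, lie strictly on one side of a hyperplane. -/
theorem VectorTransport.IsIsometric.exists_eventually_inner_hatBack_le
    {R : TangentBundle (𝓡 n) M → M} (hR : IsRetraction R)
    {T : VectorTransport R} (hT : T.IsIsometric) {f : M → ℝ} {x₀ : M}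
    (hf : ∃ K : NNReal, ∃ s ∈ 𝓝 (extChartAt (𝓡 n) x₀ x₀),
      LipschitzOnWith K (f ∘ (extChartAt (𝓡 n) x₀).symm) s)
    (h0 : (0 : TangentSpace (𝓡 n) x₀) ∉ clarkeSubdiff R f x₀) :
    ∃ (d : ∀ x : M, TangentSpace (𝓡 n) x) (B c r : ℝ), 0 < c ∧ 0 < r ∧ ∀ᶠ x in 𝓝 x₀,
      ‖d x‖ ≤ B ∧ (∀ g ∈ clarkeSubdiff R f x, inner ℝ g (d x) ≤ -c) ∧
      ∀ η : TangentSpace (𝓡 n) x, ‖η‖ < r → ∀ g ∈ clarkeSubdiff R f (R ⟨x, η⟩),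
        inner ℝ (T.hatBack x η g) (d x) ≤ -c := by
  obtain ⟨K, s, hs, hK⟩ := hf
  obtain ⟨b, c, hc, H⟩ := exists_eventually_inner_le_neg hR hs hK h0
  obtain ⟨c₀, hc₀, H₀⟩ := eventually_le_betaInv hR x₀
  obtain ⟨C, hC, HC⟩ := eventually_norm_tangentCoord_le (n := n) x₀
  have hT' := (T.tendsto_map_tangentCoordSymm x₀ b).eventually H
  obtain ⟨r, hr, Hr⟩ := eventually_forall_norm_lt (hT'.and H₀)
  have hb : Tendsto (fun x : M => (⟨x, tangentCoordSymm x₀ x b⟩ : TangentBundle (𝓡 n) M)) (𝓝 x₀)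
      (𝓝 ⟨x₀, tangentCoordSymm x₀ x₀ b⟩) :=
    (tendsto_mk_tangentCoordSymm (n := n) x₀ b).comp (tendsto_id.prodMk_nhds tendsto_const_nhds)
  -- The transport multiplies the estimate `-c` by `β⁻¹ ≥ c₀`, hence the constant `c₀ * c`; `c`
  -- itself serves for subgradients at `x`.
  refine ⟨fun x => tangentCoordSymm x₀ x b, C * ‖b‖, min c (c₀ * c), r, by positivity, hr, ?_⟩
  filter_upwards [HC, hb.eventually H, Hr] with x hx hxb hxr
  refine ⟨hx.2.2 b, fun g hg => (hxb g hg).trans (neg_le_neg (min_le_left _ _)),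
    fun η hη g hg => ?_⟩
  obtain ⟨h₁, h₂⟩ := hxr η hη
  rw [VectorTransport.hatBack, inner_smul_left, hT.inner_symm]
  have h₃ := h₁ g hg
  have h₄ := mul_le_mul_of_nonneg_left h₃ (betaInv_nonneg R x η)
  refine h₄.trans ?_
  have h₅ := mul_le_mul_of_nonneg_right h₂ hc.le
  have h₆ := min_le_right c (c₀ * c)
  linarith

end Transport

/-! ### Positive semidefiniteness of the updates -/

section QuasiNewton

variable {V : Type*} [NormedAddCommGroup V] [InnerProductSpace ℝ V]

/-- A symmetric positive semidefinite linear operator. -/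
def SymPosSemidef (H : V →ₗ[ℝ] V) : Prop :=
  H.IsSymmetric ∧ ∀ v : V, 0 ≤ inner ℝ v (H v)

theorem SymPosDef.symPosSemidef {H : V →ₗ[ℝ] V} (hH : SymPosDef H) : SymPosSemidef H := by
  refine ⟨hH.1, fun v => ?_⟩
  rcases eq_or_ne v 0 with rfl | hv
  · simp
  · exact (hH.2 v hv).le

/-- Cauchy–Schwarz for a possibly degenerate form, from the discriminant of `t ↦ ⟨x + t y, H (x + t
y)⟩ ≥ 0`. -/
theorem SymPosSemidef.inner_sq_le {H : V →ₗ[ℝ] V} (hH : SymPosSemidef H) (x y : V) :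
    inner ℝ x (H y) ^ 2 ≤ inner ℝ x (H x) * inner ℝ y (H y) := by
  have hsymm : inner ℝ y (H x) = inner ℝ x (H y) := by rw [← hH.1, real_inner_comm]
  have h := discrim_le_zero (a := inner ℝ y (H y)) (b := 2 * inner ℝ x (H y))
    (c := inner ℝ x (H x)) fun t => by
      have := hH.2 (x + t • y)
      simp only [map_add, map_smul, inner_add_left, inner_add_right, inner_smul_left,
        inner_smul_right, hsymm, RCLike.conj_to_real] at this
      linarith
  rw [discrim] at h
  linarith

theorem SymPosSemidef.smul {H : V →ₗ[ℝ] V} (hH : SymPosSemidef H) {c : ℝ} (hc : 0 ≤ c) :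
    SymPosSemidef (c • H) := by
  refine ⟨fun x y => ?_, fun v => ?_⟩
  · simp [inner_smul_left, inner_smul_right, hH.1 x y]
  · simpa [inner_smul_right] using mul_nonneg hc (hH.2 v)

theorem SymPosSemidef.add_smul_id {H : V →ₗ[ℝ] V} (hH : SymPosSemidef H) {c : ℝ} (hc : 0 ≤ c) :
    SymPosSemidef (H + c • LinearMap.id) := by
  refine ⟨fun x y => ?_, fun v => ?_⟩
  · simp [inner_add_left, inner_add_right, inner_smul_left, inner_smul_right, hH.1 x y]
  · simpa [inner_add_right, inner_smul_right] using
      add_nonneg (hH.2 v) (mul_nonneg hc (sq_nonneg ‖v‖))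

theorem inner_outer (a b x y : V) : inner ℝ x (outer a b y) = inner ℝ b y * inner ℝ x a := by
  simp [outer, inner_smul_right]

theorem outer_inner (a b x y : V) : inner ℝ (outer a b x) y = inner ℝ b x * inner ℝ a y := by
  simp [outer, inner_smul_left]

/-- The SR1 update preserves positive semidefiniteness if `v = H (u + t g)` with `t ≥ 0` and
`⟨g, v⟩ < 0`. -/
theorem SymPosSemidef.sr1 {H : V →ₗ[ℝ] V} (hH : SymPosSemidef H) {u g : V} {t : ℝ} (ht : 0 ≤ t)
    (hg : inner ℝ g (H (u + t • g)) ≤ 0) : SymPosSemidef (sr1 H u (H (u + t • g))) := by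
  set z := u + t • g with hz
  -- The sign condition makes the denominator `⟨u, v⟩` at least `⟨z, H z⟩`, so Cauchy–Schwarz
  -- absorbs the subtracted rank-one term.
  have huz : inner ℝ z (H z) ≤ inner ℝ u (H z) := by
    have e : inner ℝ z (H z) = inner ℝ u (H z) + t * inner ℝ g (H z) := by
      conv_lhs => rw [hz, inner_add_left, inner_smul_left]
      rfl
    nlinarith
  refine ⟨fun x y => ?_, fun x => ?_⟩
  · simp only [RQNBM.sr1, LinearMap.sub_apply, LinearMap.smul_apply, inner_sub_left,
      inner_sub_right, inner_smul_left, inner_smul_right, inner_outer, outer_inner, hH.1 x y,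
      RCLike.conj_to_real]
    rw [real_inner_comm x (H z)]
    ring
  · simp only [RQNBM.sr1, LinearMap.sub_apply, LinearMap.smul_apply, inner_sub_right,
      inner_smul_right, inner_outer]
    rw [real_inner_comm x (H z)]
    have h1 := hH.inner_sq_le x z
    rcases (hH.2 z).trans huz |>.eq_or_lt with h0 | h0
    -- If the denominator vanishes, the convention `0⁻¹ = 0` makes the update trivial.
    · rw [← h0]
      simpa using hH.2 x
    · rw [sub_nonneg, inv_mul_le_iff₀ h0]
      nlinarith [hH.2 x]

theorem SymPosSemidef.bfgs {H : V →ₗ[ℝ] V} (hH : SymPosSemidef H) {u s : V}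
    (hus : 0 < inner ℝ u s) : SymPosSemidef (bfgs H u s) := by
  refine ⟨fun x y => ?_, fun x => ?_⟩
  · simp only [RQNBM.bfgs, LinearMap.sub_apply, LinearMap.add_apply, LinearMap.smul_apply,
      LinearMap.comp_apply, inner_sub_left, inner_sub_right, inner_add_left, inner_add_right,
      inner_smul_left, inner_smul_right, inner_outer, outer_inner, hH.1 x y,
      RCLike.conj_to_real]
    rw [real_inner_comm x s, ← hH.1 u x, real_inner_comm (H u) x, ← hH.1 u y]
    ring
  -- The updated form at `x` is the old form at `x - (⟨s, x⟩ / ⟨u, s⟩) u` plus `⟨s, x⟩ ^ 2 / ⟨u,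
  -- s⟩`.
  · have h1 := hH.2 (x - (inner ℝ s x / inner ℝ u s) • u)
    have hsymm : inner ℝ x (H u) = inner ℝ u (H x) := by rw [← hH.1, real_inner_comm]
    simp only [map_sub, map_smul, inner_sub_left, inner_sub_right, inner_smul_left,
      inner_smul_right, hsymm, RCLike.conj_to_real] at h1
    have h2 : 0 ≤ inner ℝ s x ^ 2 / inner ℝ u s := by positivity
    simp only [RQNBM.bfgs, LinearMap.sub_apply, LinearMap.add_apply, LinearMap.smul_apply,
      LinearMap.comp_apply, inner_sub_right, inner_add_right, inner_smul_right, inner_outer,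
      hsymm, real_inner_comm s x]
    refine (add_nonneg h1 h2).trans_eq ?_
    field_simp
    ring

theorem SymPosSemidef.conj {W : Type*} [NormedAddCommGroup W] [InnerProductSpace ℝ W]
    {H : V →ₗ[ℝ] V} (hH : SymPosSemidef H) (e : V ≃ₗ[ℝ] W)
    (he : ∀ x y, inner ℝ (e x) (e y) = inner ℝ x y) :
    SymPosSemidef (e.toLinearMap ∘ₗ H ∘ₗ e.symm.toLinearMap) := by
  have h (x : W) (v : V) : inner ℝ x (e v) = inner ℝ (e.symm x) v := by
    rw [← he, LinearEquiv.apply_symm_apply]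
  refine ⟨fun x y => ?_, fun v => ?_⟩
  · simp only [LinearMap.comp_apply, LinearEquiv.coe_coe]
    rw [h, real_inner_comm, h, real_inner_comm, hH.1]
  · simp only [LinearMap.comp_apply, LinearEquiv.coe_coe]
    rw [h]
    exact hH.2 _

theorem mem_of_mem_stdSimplex_three {C : Set (V × ℝ)} (hC : Convex ℝ C) {a b c : V} {β γ : ℝ}
    {l : Fin 3 → ℝ} (hl : l ∈ stdSimplex ℝ (Fin 3)) (ha : (a, 0) ∈ C) (hb : (b, β) ∈ C)
    (hc : (c, γ) ∈ C) : (l 0 • a + l 1 • b + l 2 • c, l 1 * β + l 2 * γ) ∈ C := by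
  have hsum := hC.sum_mem (t := Finset.univ) (w := l) (z := ![(a, 0), (b, β), (c, γ)])
    (fun i _ => hl.1 i) hl.2 fun i _ => by fin_cases i <;> assumption
  simpa [Fin.sum_univ_three] using hsum

end QuasiNewton

/-! ### Stepsizes reached by the line search -/

section LineSearch

variable {n : ℕ} {M : Type*} [TopologicalSpace M] [ChartedSpace (EuclideanSpace ℝ (Fin n)) M]
  [RiemannianBundle (fun x : M => TangentSpace (𝓡 n) x)]

theorem State.norm_smul_dir {S : State n M} {t : ℝ} (ht : 0 ≤ t) :
    ‖t • S.dir‖ = t * ‖S.dir‖ := by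
  rw [norm_smul, Real.norm_of_nonneg ht]

variable [IsManifold (𝓡 n) ∞ M] {P : Params} {f : M → ℝ} {R : TangentBundle (𝓡 n) M → M}
  {T : VectorTransport R}

theorem State.LSReach.bounds {S : State n M} {tI tA tU t : ℝ} (hI : 0 < tI)
    (h : S.LSReach P f T tI tA tU t) : 0 ≤ tA ∧ tA ≤ t ∧ t ≤ tU ∧ tU ≤ tI ∧ 0 < t := by
  induction h with
  | init => exact ⟨le_rfl, hI.le, le_rfl, le_rfl, hI⟩
  | @next tA tU t _ g _ _ _ t' ht' ih =>
    obtain ⟨h1, h2, h3, h4, h5⟩ := ih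
    have hκ := P.κ_pos
    have hκ' := P.κ_lt
    obtain ⟨hA, hU⟩ := ht'
    unfold State.newA State.newU at *
    split_ifs at * with hc
    · have : 0 ≤ P.κ * (tU - t) := mul_nonneg hκ.le (by linarith)
      exact ⟨h5.le, by linarith, by linarith, h4, by linarith⟩
    · have : 0 ≤ P.κ * (t - tA) := mul_nonneg hκ.le (by linarith)
      refine ⟨h1, by linarith, by linarith, by linarith, ?_⟩
      -- Positivity when `tA` may be `0`: the new stepsize is at least `(1 - κ) tA + κ t`.
      nlinarith

theorem State.LSReach.norm_le {S : State n M} {tI tA tU t : ℝ} (hI : S.IsInitStep P tI)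
    (h : S.LSReach P f T tI tA tU t) : 0 < t ∧ ‖t • S.dir‖ ≤ P.μ₀ := by
  obtain ⟨-, -, h3, h4, h5⟩ := h.bounds hI.1
  refine ⟨h5, ?_⟩
  rw [State.norm_smul_dir h5.le]
  exact (mul_le_mul_of_nonneg_right (h3.trans h4) (norm_nonneg _)).trans hI.2.2

end LineSearch

/-! ### Invariants of one iteration -/

section Iteration

variable {n : ℕ} {M : Type*} [TopologicalSpace M] [ChartedSpace (EuclideanSpace ℝ (Fin n)) M]
  [RiemannianBundle (fun x : M => TangentSpace (𝓡 n) x)]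

theorem SymPosSemidef.scaled (P : Params) {x : M} (gt : TangentSpace (𝓡 n) x)
    {Hc : TangentSpace (𝓡 n) x →ₗ[ℝ] TangentSpace (𝓡 n) x} (hH : SymPosSemidef Hc) :
    SymPosSemidef (scaled P gt Hc) := by
  unfold RQNBM.scaled
  split_ifs
  · exact hH.smul (div_nonneg P.D_pos.le (norm_nonneg _))
  · exact hH

theorem norm_scaled_le (P : Params) {x : M} (gt : TangentSpace (𝓡 n) x)
    (Hc : TangentSpace (𝓡 n) x →ₗ[ℝ] TangentSpace (𝓡 n) x) : ‖scaled P gt Hc gt‖ ≤ P.D := by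
  unfold scaled
  split_ifs with h
  · have h0 : 0 < ‖Hc gt‖ := P.D_pos.trans h
    rw [LinearMap.smul_apply, norm_smul, Real.norm_of_nonneg (div_nonneg P.D_pos.le h0.le),
      div_mul_cancel₀ _ h0.ne']
  · exact not_lt.1 h

variable [IsManifold (𝓡 n) ∞ M] {P : Params} {f : M → ℝ} {R : TangentBundle (𝓡 n) M → M}
  {T : VectorTransport R}

/-- The invariant of the method: positive semidefiniteness, and the lower bound for `w_k` that
the corrections enforce. -/
structure State.WellFormed (P : Params) (S : State n M) : Prop where
  psd : SymPosSemidef S.H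
  αt_nonneg : 0 ≤ S.αt
  le_w : P.ρ * ‖S.gt‖ ^ 2 ≤ S.w
  αt_le_w : 2 * S.αt ≤ S.w

open Classical in
-- Semidefiniteness gives `w̌ ≥ 2 α̃ ≥ 0`. Either the correction adds `ρ ‖g̃‖ ^ 2` to this, or it is
-- skipped because `w̌` already exceeds that bound.
theorem wellFormed_finish (x : M) (gm gt : TangentSpace (𝓡 n) x) {αt : ℝ} (hα : 0 ≤ αt)
    {Hc : TangentSpace (𝓡 n) x →ₗ[ℝ] TangentSpace (𝓡 n) x} (hH : SymPosSemidef Hc) (iU : Prop)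
    (nC : ℕ) (iC : Prop) : (finish P x gm gt αt Hc iU nC iC).WellFormed P := by
  have hs := hH.scaled P gt
  have hw : 2 * αt ≤ wCheck P gt αt Hc := by
    unfold wCheck
    linarith [hs.2 gt]
  have hρ : 0 ≤ P.ρ * ‖gt‖ ^ 2 := mul_nonneg P.ρ_pos.le (sq_nonneg _)
  constructor
  · change SymPosSemidef (V := TangentSpace (𝓡 n) x)
      (if NeedsCorrection P gt αt Hc iU iC then scaled P gt Hc + P.ρ • LinearMap.id
        else scaled P gt Hc)
    split_ifs
    · exact hs.add_smul_id P.ρ_pos.le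
    · exact hs
  · exact hα
  · change P.ρ * ‖gt‖ ^ 2 ≤ ite _ _ _
    split_ifs with hN
    · linarith
    · exact not_lt.1 fun h => hN (Or.inl h)
  · change 2 * αt ≤ ite _ _ _
    split_ifs
    · linarith
    · exact hw

open Classical in
theorem norm_dir_finish_le (x : M) (gm gt : TangentSpace (𝓡 n) x) (αt : ℝ)
    (Hc : TangentSpace (𝓡 n) x →ₗ[ℝ] TangentSpace (𝓡 n) x) (iU : Prop)
    (nC : ℕ) (iC : Prop) :
    ‖(finish P x gm gt αt Hc iU nC iC).dir‖ ≤ P.D + P.ρ * ‖gt‖ := by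
  have hs := norm_scaled_le P gt Hc
  have hρ : 0 ≤ P.ρ * ‖gt‖ := mul_nonneg P.ρ_pos.le (norm_nonneg _)
  rw [State.dir, norm_neg]
  change ‖(ite _ _ _ : TangentSpace (𝓡 n) x →ₗ[ℝ] TangentSpace (𝓡 n) x) gt‖ ≤ _
  split_ifs
  · refine (norm_add_le _ _).trans (add_le_add hs ?_)
    rw [LinearMap.smul_apply, LinearMap.id_apply, norm_smul, Real.norm_of_nonneg P.ρ_pos.le]
  · exact hs.trans (le_add_of_nonneg_right hρ)

theorem State.Iter.null_or_serious {S S' : State n M} {tL tR : ℝ} (h : S.Iter P f T tL tR S') :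
    (∃ (t : ℝ) (g : TangentSpace (𝓡 n) (S.trial R t)) (l : Fin 3 → ℝ), tL = 0 ∧
      S.NullExit P f T t g ∧
      IsQPSolution S.H S.gm (T.hatBack S.x (t • S.dir) g) S.gt (S.delta P f T t g) S.αt l ∧
      S' = S.nullNext P f T t g l) ∨
    ∃ g : TangentSpace (𝓡 n) (S.trial R tL), S.SeriousExit P f T tL g ∧
      S' = S.seriousNext P T tL g := by
  cases h with
  | null t g l hexit hl => exact Or.inl ⟨_, g, l, rfl, hexit, hl, rfl⟩
  | serious t g hexit => exact Or.inr ⟨g, hexit, rfl⟩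

theorem State.Iter.norm_dir_le {S S' : State n M} {tL tR : ℝ} (h : S.Iter P f T tL tR S') :
    ‖S'.dir‖ ≤ P.D + P.ρ * ‖S'.gt‖ := by
  rcases h.null_or_serious with ⟨t, g, l, rfl, hexit, hl, rfl⟩ | ⟨g, hexit, rfl⟩
  · exact norm_dir_finish_le _ _ _ _ _ _ _ _
  · exact norm_dir_finish_le _ _ _ _ _ _ _ _

theorem State.delta_nonneg {S : State n M} {t : ℝ} (g : TangentSpace (𝓡 n) (S.trial R t)) :
    0 ≤ S.delta P f T t g :=
  (abs_nonneg _).trans (le_max_left _ _)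

theorem State.Iter.wellFormed (hT : T.IsIsometric) {S S' : State n M} {tL tR : ℝ}
    (h : S.Iter P f T tL tR S') (hS : S.WellFormed P) : S'.WellFormed P := by
  rcases h.null_or_serious with ⟨t, g, l, rfl, hexit, hl, rfl⟩ | ⟨g, hexit, rfl⟩
  · obtain ⟨tI, tA, tU, hI, hreach, -, -, -⟩ := hexit
    have ht := (hreach.norm_le hI).1
    refine wellFormed_finish _ _ _ (add_nonneg (mul_nonneg (hl.1.1 1) (S.delta_nonneg g))
      (mul_nonneg (hl.1.1 2) hS.αt_nonneg)) ?_ _ _ _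
    split_ifs with hc
    -- Since `d = -H g̃`, the vector `v = H ũ - t d` has the form `H (ũ + t g̃)` required by
    -- `SymPosSemidef.sr1`.
    · have hv : S.nullV T t g = S.H (S.nullU T t g + t • S.gt) := by
        rw [State.nullV, State.dir, smul_neg, sub_neg_eq_add, map_add, map_smul]
      rw [hv]
      refine hS.psd.sr1 ht.le ?_
      rw [← hv]
      exact hc.1.le
    · exact hS.psd
  · have hH : SymPosSemidef (S.seriousH T tL) := hS.psd.conj _ (hT _ _)
    refine wellFormed_finish _ _ _ le_rfl ?_ _ _ _
    split_ifs with hc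
    · exact hH.bfgs (P.ρ_pos.trans hc)
    · exact hH

/-- A convex set in each `T_x M × ℝ` that contains the new pairs of a subgradient and its
locality measure contains the aggregate pair. -/
theorem State.Iter.aggregate_mem {C : ∀ x : M, Set (TangentSpace (𝓡 n) x × ℝ)} {U : Set M}
    (hC : ∀ x ∈ U, Convex ℝ (C x))
    (h₁ : ∀ x ∈ U, ∀ g ∈ clarkeSubdiff R f x, (g, 0) ∈ C x)
    (h₂ : ∀ x ∈ U, ∀ η : TangentSpace (𝓡 n) x, ‖η‖ ≤ P.μ₀ →
      ∀ g ∈ clarkeSubdiff R f (R ⟨x, η⟩), ∀ α : ℝ, P.γ * ‖η‖ ^ P.ν ≤ α →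
        (T.hatBack x η g, α) ∈ C x)
    {S S' : State n M} {tL tR : ℝ} (h : S.Iter P f T tL tR S')
    (hS : S.x ∈ U → (S.gm, 0) ∈ C S.x ∧ (S.gt, S.αt) ∈ C S.x) :
    S'.x ∈ U → (S'.gm, 0) ∈ C S'.x ∧ (S'.gt, S'.αt) ∈ C S'.x := by
  rcases h.null_or_serious with ⟨t, g, l, rfl, hexit, hl, rfl⟩ | ⟨g, hexit, rfl⟩
  · intro hx
    obtain ⟨hgm, hgt⟩ := hS hx
    refine ⟨hgm, ?_⟩
    obtain ⟨tI, tA, tU, hI, hreach, hg, -, -⟩ := hexit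
    obtain ⟨ht, hη⟩ := hreach.norm_le hI
    have hnew := h₂ S.x hx (t • S.dir) hη g hg (S.delta P f T t g) (by
      rw [State.norm_smul_dir ht.le]
      exact le_max_right _ _)
    exact mem_of_mem_stdSimplex_three (hC S.x hx) hl.1 hgm hnew hgt
  -- A serious step discards the old pair, so nothing need be known about earlier centers, which may
  -- lie outside `U`.
  · intro hx
    obtain ⟨tI, tA, tU, hI, hreach, hg, -⟩ := hexit
    have := h₁ _ hx g hg
    exact ⟨this, this⟩

theorem State.Iter.descent {S S' : State n M} {tL tR : ℝ} (h : S.Iter P f T tL tR S') :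
    f S'.x ≤ f S.x - P.θL * tL * S.w := by
  rcases h.null_or_serious with ⟨t, g, l, rfl, hexit, hl, rfl⟩ | ⟨g, hexit, rfl⟩
  · simp [State.nullNext, finish]
  · obtain ⟨tI, tA, tU, hI, hreach, hg, hs⟩ := hexit
    exact hs.1

theorem State.Iter.tL_nonneg {S S' : State n M} {tL tR : ℝ} (h : S.Iter P f T tL tR S') :
    0 ≤ tL := by
  rcases h.null_or_serious with ⟨t, g, l, rfl, hexit, hl, rfl⟩ | ⟨g, hexit, rfl⟩
  · exact le_rfl
  · obtain ⟨tI, tA, tU, hI, hreach, hg, hs⟩ := hexit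
    exact (hreach.norm_le hI).1.le

theorem State.Iter.x_eq_of_not_pos {S S' : State n M} {tL tR : ℝ} (h : S.Iter P f T tL tR S')
    (h0 : ¬ 0 < tL) : S'.x = S.x := by
  rcases h.null_or_serious with ⟨t, g, l, rfl, hexit, hl, rfl⟩ | ⟨g, hexit, rfl⟩
  · rfl
  · obtain ⟨tI, tA, tU, hI, hreach, hg, hs⟩ := hexit
    exact absurd (hreach.norm_le hI).1 h0

/-- A short serious step is taken only if the locality measure is large. -/
theorem State.Iter.lt_delta_of_lt {S S' : State n M} {tL tR : ℝ} (h : S.Iter P f T tL tR S')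
    (h0 : 0 < tL) (hlt : tL < P.tmin) : ‖tL • S.dir‖ ≤ P.μ₀ ∧
      ∃ g ∈ clarkeSubdiff R f (S.trial R tL), P.θA * S.w < S.delta P f T tL g := by
  rcases h.null_or_serious with ⟨t, g, l, rfl, hexit, hl, rfl⟩ | ⟨g, hexit, rfl⟩
  · exact absurd h0 (lt_irrefl _)
  · obtain ⟨tI, tA, tU, hI, hreach, hg, hs⟩ := hexit
    exact ⟨(hreach.norm_le hI).2, g, hg, hs.2.resolve_left (not_le.2 hlt)⟩

end Iteration

/-! ### Infinite runs and the contradiction -/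

section Run

variable {n : ℕ} {M : Type*} [TopologicalSpace M] [ChartedSpace (EuclideanSpace ℝ (Fin n)) M]
  [IsManifold (𝓡 n) ∞ M] [RiemannianBundle (fun x : M => TangentSpace (𝓡 n) x)]
  {P : Params} {f : M → ℝ} {R : TangentBundle (𝓡 n) M → M} {T : VectorTransport R}
  {S : ℕ → State n M} {tL tR : ℕ → ℝ}

theorem IsRun.wellFormed (hrun : IsRun P f T S tL tR) (hT : T.IsIsometric) (k : ℕ) :
    (S k).WellFormed P := by
  induction k with
  | zero =>
    obtain ⟨-, -, hH, hα, hw, -⟩ := hrun.start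
    rw [real_inner_self_eq_norm_sq] at hw
    refine ⟨hH.symPosSemidef, hα.ge, ?_, ?_⟩
    · rw [hw]
      exact mul_le_of_le_one_left (sq_nonneg _) P.ρ_lt.le
    · rw [hw, hα, mul_zero]
      exact sq_nonneg _
  | succ k ih => exact (hrun.iter k).wellFormed hT ih

theorem IsRun.w_pos (hrun : IsRun P f T S tL tR) (k : ℕ) : 0 < (S k).w :=
  P.ε_nonneg.trans_lt (hrun.not_stopped k)

theorem IsRun.antitone (hrun : IsRun P f T S tL tR) : Antitone fun k => f (S k).x := by
  refine antitone_nat_of_succ_le fun k => (hrun.iter k).descent.trans (sub_le_self _ ?_)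
  exact mul_nonneg (mul_nonneg P.θL_pos.le (hrun.iter k).tL_nonneg) (hrun.w_pos k).le

theorem IsRun.aggregate_mem (hrun : IsRun P f T S tL tR)
    {C : ∀ x : M, Set (TangentSpace (𝓡 n) x × ℝ)} {U : Set M}
    (hC : ∀ x ∈ U, Convex ℝ (C x))
    (h₁ : ∀ x ∈ U, ∀ g ∈ clarkeSubdiff R f x, (g, 0) ∈ C x)
    (h₂ : ∀ x ∈ U, ∀ η : TangentSpace (𝓡 n) x, ‖η‖ ≤ P.μ₀ →
      ∀ g ∈ clarkeSubdiff R f (R ⟨x, η⟩), ∀ α : ℝ, P.γ * ‖η‖ ^ P.ν ≤ α →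
        (T.hatBack x η g, α) ∈ C x) (k : ℕ) :
    (S k).x ∈ U → ((S k).gm, 0) ∈ C (S k).x ∧ ((S k).gt, (S k).αt) ∈ C (S k).x := by
  induction k with
  | zero =>
    intro hx
    obtain ⟨hgm, hgt, -, hα, -⟩ := hrun.start
    rw [hgt, hα]
    exact ⟨h₁ _ hx _ hgm, h₁ _ hx _ hgm⟩
  | succ k ih => exact (hrun.iter k).aggregate_mem hC h₁ h₂ ih

/-- Each stability center is left by a serious step. -/
theorem IsRun.exists_serious_ge (hrun : IsRun P f T S tL tR)
    (hserious : {k : ℕ | 0 < tL k}.Infinite) (k : ℕ) :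
    ∃ k' ≥ k, 0 < tL k' ∧ (S k').x = (S k).x := by
  classical
  have hex : ∃ j, 0 < tL (k + j) := by
    obtain ⟨m, hm, hkm⟩ := hserious.exists_gt k
    exact ⟨m - k, by rwa [Nat.add_sub_cancel' hkm.le]⟩
  refine ⟨k + Nat.find hex, Nat.le_add_right _ _, Nat.find_spec hex, ?_⟩
  have h : ∀ j ≤ Nat.find hex, (S (k + j)).x = (S k).x := by
    intro j
    induction j with
    | zero => exact fun _ => rfl
    | succ j ih =>
      intro hj
      exact ((hrun.iter (k + j)).x_eq_of_not_pos (Nat.find_min hex hj)).trans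
        (ih (Nat.le_of_succ_le hj))
  exact h _ le_rfl

theorem IsRun.tendsto_f (hrun : IsRun P f T S tL tR) (hf : Continuous f) {x₀ : M}
    (hcluster : MapClusterPt x₀ atTop fun k => (S k).x) :
    Tendsto (fun k => f (S k).x) atTop (𝓝 (f x₀)) := by
  have hc : MapClusterPt (f x₀) atTop fun k => f (S k).x :=
    hcluster.continuousAt_comp hf.continuousAt
  have hfreq := mapClusterPt_iff_frequently.1 hc
  refine Metric.tendsto_atTop.2 fun ε hε => ?_
  obtain ⟨K, -, hK⟩ := frequently_atTop.1 (hfreq _ (Metric.ball_mem_nhds _ hε)) 0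
  refine ⟨K, fun k hk => ?_⟩
  have h1 : f (S k).x ≤ f (S K).x := hrun.antitone hk
  -- A nonincreasing sequence that once falls below a cluster value can never return near it.
  have h2 : f x₀ ≤ f (S k).x := by
    by_contra! hlt
    obtain ⟨m, hm, hm'⟩ := frequently_atTop.1 (hfreq _ (Ioi_mem_nhds hlt)) k
    exact absurd (hrun.antitone hm) (not_le.2 hm')
  rw [Metric.mem_ball, Real.dist_eq] at hK
  rw [Real.dist_eq, abs_of_nonneg (sub_nonneg.2 h2)]
  linarith [le_abs_self (f (S K).x - f x₀)]

variable [IsContinuousRiemannianBundle (EuclideanSpace ℝ (Fin n))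
  (fun x : M => TangentSpace (𝓡 n) x)]

/-- Near a point that is not stationary, the aggregate subgradients are bounded and the numbers
`w_k` are bounded away from zero. -/
theorem IsRun.exists_eventually_le_w (hrun : IsRun P f T S tL tR) (hR : IsRetraction R)
    (hT : T.IsIsometric)
    (hf : ∀ x : M, ∃ K : NNReal, ∃ s ∈ 𝓝 (extChartAt (𝓡 n) x x),
      LipschitzOnWith K (f ∘ (extChartAt (𝓡 n) x).symm) s) {x₀ : M}
    (h0 : (0 : TangentSpace (𝓡 n) x₀) ∉ clarkeSubdiff R f x₀) :
    ∃ w₀ C : ℝ, 0 < w₀ ∧ ∀ᶠ x in 𝓝 x₀, ∀ k, (S k).x = x → w₀ ≤ (S k).w ∧ ‖(S k).gt‖ ≤ C := by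
  obtain ⟨d, B, c, r, hc, hr, H⟩ := hT.exists_eventually_inner_hatBack_le hR (hf x₀) h0
  obtain ⟨C₁, HC₁⟩ := hT.exists_eventually_norm_hatBack_le hR hf x₀ P.μ₀
  obtain ⟨K, s, hs, hK⟩ := hf x₀
  obtain ⟨C₂, hC₂, HC₂⟩ := eventually_norm_le_of_mem_clarkeSubdiff hR hs hK
  have hB : 0 ≤ B := (norm_nonneg _).trans H.self_of_nhds.1
  set C := max C₁ C₂ with hCdef
  have hC0 : 0 ≤ C := hC₂.trans (le_max_right _ _)
  have hγr : 0 < P.γ * r ^ P.ν := mul_pos P.γ_pos (Real.rpow_pos_of_pos hr _)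
  -- For a trial step of length at least `r`, the measure is at least `γ r ^ ν`, so `A α ≥ C B + c`
  -- compensates the worst possible inner product `C B`.
  set A := (C * B + c) / (P.γ * r ^ P.ν) with hA
  have hA0 : 0 ≤ A := by positivity
  set U := {x : M | (‖d x‖ ≤ B ∧ (∀ g ∈ clarkeSubdiff R f x, inner ℝ g (d x) ≤ -c) ∧
      ∀ η : TangentSpace (𝓡 n) x, ‖η‖ < r → ∀ g ∈ clarkeSubdiff R f (R ⟨x, η⟩),
        inner ℝ (T.hatBack x η g) (d x) ≤ -c) ∧
      (∀ η : TangentSpace (𝓡 n) x, ‖η‖ ≤ P.μ₀ →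
      ∀ g ∈ clarkeSubdiff R f (R ⟨x, η⟩), ‖T.hatBack x η g‖ ≤ C₁) ∧
      ∀ g ∈ clarkeSubdiff R f x, ‖g‖ ≤ C₂} with hU
  have hUn : U ∈ 𝓝 x₀ := H.and (HC₁.and HC₂)
  have hagg := hrun.aggregate_mem (U := U)
    (C := fun x => {p | ‖p.1‖ ≤ C ∧ inner ℝ p.1 (d x) ≤ -c + A * p.2})
    (by
      rintro x - ⟨v, α⟩ ⟨hv, hv'⟩ ⟨v', α'⟩ ⟨hu, hu'⟩ a b ha hb hab
      constructor
      · calc ‖a • v + b • v'‖ ≤ a * ‖v‖ + b * ‖v'‖ := by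
              refine (norm_add_le _ _).trans_eq ?_
              rw [norm_smul, norm_smul, Real.norm_of_nonneg ha, Real.norm_of_nonneg hb]
          _ ≤ a * C + b * C :=
              add_le_add (mul_le_mul_of_nonneg_left hv ha) (mul_le_mul_of_nonneg_left hu hb)
          _ = C := by rw [← add_mul, hab, one_mul]
      · change inner ℝ (a • v + b • v') (d x) ≤ -c + A * (a * α + b * α')
        rw [inner_add_left, real_inner_smul_left, real_inner_smul_left]
        calc a * inner ℝ v (d x) + b * inner ℝ v' (d x)
            ≤ a * (-c + A * α) + b * (-c + A * α') :=
              add_le_add (mul_le_mul_of_nonneg_left hv' ha) (mul_le_mul_of_nonneg_left hu' hb)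
          _ = (a + b) * -c + A * (a * α + b * α') := by ring
          _ = -c + A * (a * α + b * α') := by rw [hab, one_mul])
    (fun x hx g hg => ⟨(hx.2.2 g hg).trans (le_max_right _ _), by
      simpa using hx.1.2.1 g hg⟩)
    (fun x hx η hη g hg α hα => by
      have hn : ‖T.hatBack x η g‖ ≤ C := (hx.2.1 η hη g hg).trans (le_max_left _ _)
      have hα0 : 0 ≤ α := (mul_nonneg P.γ_pos.le (Real.rpow_nonneg (norm_nonneg _) _)).trans hα
      refine ⟨hn, ?_⟩
      rcases lt_or_ge ‖η‖ r with hlt | hge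
      · exact (hx.1.2.2 η hlt g hg).trans (le_add_of_nonneg_right (mul_nonneg hA0 hα0))
      · have h1 : P.γ * r ^ P.ν ≤ α := (mul_le_mul_of_nonneg_left
          (Real.rpow_le_rpow hr.le hge (zero_le_one.trans P.one_le_ν)) P.γ_pos.le).trans hα
        have h2 : C * B + c ≤ A * α := by
          have := mul_le_mul_of_nonneg_left h1 hA0
          rwa [hA, div_mul_cancel₀ _ hγr.ne'] at this
        have h3 : inner ℝ (T.hatBack x η g) (d x) ≤ C * B :=
          (real_inner_le_norm _ _).trans (mul_le_mul hn hx.1.1 (norm_nonneg _) hC0)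
        change inner ℝ (T.hatBack x η g) (d x) ≤ -c + A * α
        linarith)
  have hρ := P.ρ_pos
  -- Below this threshold both `A α̃ ≤ c / 2` and `B ‖g̃‖ < c / 2`, contradicting `-B ‖g̃‖ ≤ ⟨g̃, d⟩
  -- ≤ -c + A α̃`. Adding `1` guards against `A = 0` and `B = 0`.
  refine ⟨min (c / (A + 1)) (P.ρ * (c / (2 * (B + 1))) ^ 2), C, by positivity, ?_⟩
  filter_upwards [hUn] with x hxU k hk
  subst hk
  obtain ⟨hgC, hin⟩ := (hagg k hxU).2
  refine ⟨?_, hgC⟩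
  by_contra! hlt
  have hwf := hrun.wellFormed hT k
  have e1 : A * (S k).αt ≤ c / 2 := by
    have h1 : (S k).w < c / (A + 1) := hlt.trans_le (min_le_left _ _)
    rw [lt_div_iff₀ (by positivity)] at h1
    have h2 := hwf.αt_le_w
    have h3 := hwf.αt_nonneg
    nlinarith
  have e2 : B * ‖(S k).gt‖ < c / 2 := by
    have h1 : P.ρ * ‖(S k).gt‖ ^ 2 < P.ρ * (c / (2 * (B + 1))) ^ 2 :=
      hwf.le_w.trans_lt (hlt.trans_le (min_le_right _ _))
    have h2 : ‖(S k).gt‖ < c / (2 * (B + 1)) :=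
      lt_of_pow_lt_pow_left₀ 2 (by positivity) (lt_of_mul_lt_mul_left h1 hρ.le)
    rw [lt_div_iff₀ (by positivity)] at h2
    nlinarith [norm_nonneg (S k).gt]
  have e3 : -(B * ‖(S k).gt‖) ≤ inner ℝ (S k).gt (d (S k).x) := by
    have h1 := (abs_le.1 (abs_real_inner_le_norm (S k).gt (d (S k).x))).1
    have h2 := mul_le_mul_of_nonneg_left hxU.1.1 (norm_nonneg (S k).gt)
    linarith
  change inner ℝ (S k).gt (d (S k).x) ≤ -c + A * (S k).αt at hin
  linarith

/-- The locality measure of a short trial step is small. -/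
theorem exists_eventually_delta_le (P : Params) (hR : IsRetraction R) (hT : T.IsIsometric)
    (hfc : Continuous f)
    (hf : ∀ x : M, ∃ K : NNReal, ∃ s ∈ 𝓝 (extChartAt (𝓡 n) x x),
      LipschitzOnWith K (f ∘ (extChartAt (𝓡 n) x).symm) s) (x₀ : M) {ε : ℝ} (hε : 0 < ε) :
    ∃ r : ℝ, 0 < r ∧ ∀ᶠ x in 𝓝 x₀, ∀ (S : State n M) (t : ℝ), S.x = x → 0 ≤ t →
      ‖t • S.dir‖ ≤ P.μ₀ → ‖t • S.dir‖ < r → ∀ g ∈ clarkeSubdiff R f (S.trial R t),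
      S.delta P f T t g ≤ ε := by
  obtain ⟨C, HC⟩ := hT.exists_eventually_norm_hatBack_le hR hf x₀ P.μ₀
  have hcont : Tendsto (fun p : TangentBundle (𝓡 n) M => |f p.1 - f (R p)|) (𝓝 ⟨x₀, 0⟩) (𝓝 0) := by
    have h1 := (hfc.tendsto x₀).comp (tendsto_proj_nhds (⟨x₀, 0⟩ : TangentBundle (𝓡 n) M))
    have h2 := (hfc.comp hR.smooth.continuous).tendsto (⟨x₀, 0⟩ : TangentBundle (𝓡 n) M)
    simpa [hR.map_zero] using (h1.sub h2).abs
  obtain ⟨r₁, hr₁, H₁⟩ := eventually_forall_norm_lt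
    (hcont.eventually_lt_const (show (0 : ℝ) < ε / 2 by positivity))
  have hν := zero_lt_one.trans_le P.one_le_ν
  have hpow : Tendsto (fun s : ℝ => P.γ * s ^ P.ν) (𝓝 0) (𝓝 0) := by
    have := ((Real.continuous_rpow_const hν.le).const_mul P.γ).tendsto 0
    simpa [Real.zero_rpow hν.ne'] using this
  obtain ⟨r₂, hr₂, H₂⟩ := Metric.eventually_nhds_iff_ball.1 (hpow.eventually_lt_const hε)
  -- `r₁` makes the change of `f` less than `ε / 2`, the last bound makes the linear term at most `ε
  -- / 2`, and `r₂` handles `γ ‖t d‖ ^ ν`.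
  refine ⟨min r₁ (min r₂ (ε / (2 * (|C| + 1)))), by positivity, ?_⟩
  filter_upwards [HC, H₁] with x hxC hx₁ S t hS ht hμ hr g hg
  subst hS
  have hr₁' := hr.trans_le (min_le_left _ _)
  have hr₂' := hr.trans_le ((min_le_right _ _).trans (min_le_left _ _))
  have hr₃' := hr.trans_le ((min_le_right _ _).trans (min_le_right _ _))
  refine max_le ?_ ?_
  · have h1 : |f S.x - f (S.trial R t)| < ε / 2 := hx₁ _ hr₁'
    have h2 : |t * S.slope T t g| ≤ ε / 2 := by
      have e : t * S.slope T t g = inner ℝ (T.hatBack S.x (t • S.dir) g) (t • S.dir) := by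
        rw [State.slope, real_inner_smul_right]
      rw [e]
      refine (abs_real_inner_le_norm _ _).trans ?_
      rw [lt_div_iff₀ (by positivity)] at hr₃'
      have h3 := mul_le_mul_of_nonneg_right ((hxC _ hμ g hg).trans (le_abs_self C))
        (norm_nonneg (t • S.dir))
      nlinarith [norm_nonneg (t • S.dir)]
    exact (abs_add_le _ _).trans (by linarith)
  · rw [← State.norm_smul_dir ht]
    refine (H₂ _ ?_).le
    rwa [mem_ball_zero_iff, norm_norm]

/-- Convergence for infinitely many serious steps, with the Lipschitz condition in charts. -/
theorem IsRun.zero_mem_clarkeSubdiff (hrun : IsRun P f T S tL tR) (hR : IsRetraction R)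
    (hT : T.IsIsometric) (hfc : Continuous f)
    (hf : ∀ x : M, ∃ K : NNReal, ∃ s ∈ 𝓝 (extChartAt (𝓡 n) x x),
      LipschitzOnWith K (f ∘ (extChartAt (𝓡 n) x).symm) s)
    (hserious : {k : ℕ | 0 < tL k}.Infinite) {x₀ : M}
    (hcluster : MapClusterPt x₀ atTop fun k => (S k).x) :
    (0 : TangentSpace (𝓡 n) x₀) ∈ clarkeSubdiff R f x₀ := by
  by_contra h0
  obtain ⟨w₀, C, hw₀, Hw⟩ := hrun.exists_eventually_le_w hR hT hf h0
  have hθA := P.θA_pos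
  have hθL := P.θL_pos
  have hρ := P.ρ_pos
  have hD := P.D_pos
  obtain ⟨r, hr, Hr⟩ := exists_eventually_delta_le P hR hT hfc hf x₀ (mul_pos hθA hw₀)
  set L := P.D + P.ρ * |C| with hL
  have hL0 : 0 < L := by positivity
  -- A stepsize below `τ` is below `t_min` and, as `‖d‖ ≤ L`, gives a step shorter than `r`.
  set τ := min P.tmin (r / L) with hτ
  have hτ0 : 0 < τ := lt_min P.tmin_pos (by positivity)
  have hdec : ∀ᶠ k in atTop, f (S k).x - f (S (k + 1)).x < P.θL * τ * w₀ := by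
    have ht := hrun.tendsto_f hfc hcluster
    have h1 := ht.sub (ht.comp (tendsto_add_atTop_nat 1))
    rw [sub_self] at h1
    exact h1.eventually_lt_const (by positivity)
  -- Index `0` is excluded because the bound on the direction comes from the scaling in the
  -- preceding iteration, and the initial operator is not scaled.
  obtain ⟨K, hK⟩ := eventually_atTop.1 (hdec.and (eventually_ge_atTop 1))
  obtain ⟨k, hk, hkU⟩ := frequently_atTop.1
    (mapClusterPt_iff_frequently.1 hcluster _ (Hw.and Hr)) K
  -- Iteration `k` itself may be a null step; the serious step that leaves the same center is used
  -- instead.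
  obtain ⟨j, hj, hjpos, hjx⟩ := hrun.exists_serious_ge hserious k
  rw [← hjx] at hkU
  obtain ⟨hw, hr'⟩ := hkU
  obtain ⟨hwj, hCj⟩ := hw j rfl
  obtain ⟨hdecj, hj1⟩ := hK j (hk.trans hj)
  have htτ : tL j < τ := by
    have h1 := (hrun.iter j).descent
    have h2 : P.θL * tL j * w₀ ≤ P.θL * tL j * (S j).w :=
      mul_le_mul_of_nonneg_left hwj (by positivity)
    have h3 : P.θL * tL j * w₀ < P.θL * τ * w₀ := by linarith
    exact lt_of_mul_lt_mul_left (lt_of_mul_lt_mul_right h3 hw₀.le) hθL.le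
  have hdir : ‖(S j).dir‖ ≤ L := by
    obtain ⟨i, rfl⟩ := Nat.exists_eq_add_of_le' hj1
    refine (hrun.iter i).norm_dir_le.trans ?_
    have := mul_le_mul_of_nonneg_left (hCj.trans (le_abs_self C)) hρ.le
    linarith
  obtain ⟨hμ, g, hg, hlt⟩ := (hrun.iter j).lt_delta_of_lt hjpos (htτ.trans_le (min_le_left _ _))
  have hshort : ‖tL j • (S j).dir‖ < r := by
    rw [State.norm_smul_dir hjpos.le]
    calc tL j * ‖(S j).dir‖ ≤ tL j * L := mul_le_mul_of_nonneg_left hdir hjpos.le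
      _ < r / L * L := mul_lt_mul_of_pos_right (htτ.trans_le (min_le_right _ _)) hL0
      _ = r := div_mul_cancel₀ _ hL0.ne'
  have h1 := hr' (S j) (tL j) rfl hjpos.le hμ hshort g hg
  have h2 := mul_le_mul_of_nonneg_left hwj hθA.le
  linarith

end Run

end RQNBM

end

/-- Let `M` be a complete `n`-dimensional Riemannian manifold, with a retraction `R` and an
isometric vector transport `T` that satisfies the locking condition, and let `f` be locally
Lipschitz with bounded initial level set. If the method (with tolerance `0`) makes infinitely many
serious steps, then every cluster point of the stability centers is a stationary point of `f`. -/
theorem mainTheorem2 {n : ℕ} {M : Type*} [MetricSpace M]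
    [ChartedSpace (EuclideanSpace ℝ (Fin n)) M] [IsManifold (𝓡 n) ∞ M]
    [RiemannianBundle (fun x : M => TangentSpace (𝓡 n) x)]
    [IsContMDiffRiemannianBundle (𝓡 n) ∞ (EuclideanSpace ℝ (Fin n))
      (fun x : M => TangentSpace (𝓡 n) x)]
    [IsRiemannianManifold (𝓡 n) M] [CompleteSpace M]
    (R : TangentBundle (𝓡 n) M → M) (hR : RQNBM.IsRetraction R)
    (T : RQNBM.VectorTransport R) (hTiso : T.IsIsometric) (hTlock : T.IsLocking)
    (f : M → ℝ) (hf : LocallyLipschitz f)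
    (P : RQNBM.Params) (hμ : ENNReal.ofReal P.μ₀ < RQNBM.injRadius R) (hε : P.ε = 0)
    (S : ℕ → RQNBM.State n M) (tL tR : ℕ → ℝ) (hrun : RQNBM.IsRun P f T S tL tR)
    (hlevel : Bornology.IsBounded {x : M | f x ≤ f (S 0).x})
    (hserious : {k : ℕ | 0 < tL k}.Infinite)
    (xstar : M) (hcluster : MapClusterPt xstar atTop (fun k => (S k).x)) :
    (0 : TangentSpace (𝓡 n) xstar) ∈ RQNBM.clarkeSubdiff R f xstar := by
  -- The smooth metric is in particular a continuous one, with the same underlying section.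
  obtain ⟨g, hg, hinner⟩ := IsContMDiffRiemannianBundle.exists_contMDiff (IB := 𝓡 n) (n := ∞)
    (F := EuclideanSpace ℝ (Fin n)) (E := fun x : M => TangentSpace (𝓡 n) x)
  have : IsContinuousRiemannianBundle (EuclideanSpace ℝ (Fin n))
      (fun x : M => TangentSpace (𝓡 n) x) := ⟨g, hg.continuous, hinner⟩
  exact hrun.zero_mem_clarkeSubdiff hR hTiso hf.continuous
    (RQNBM.exists_lipschitzOnWith_comp_extChartAt_symm hf) hserious hcluster
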